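/- **Setting.** Let $N\ge 1$ agents communicate over an undirected connected graph $\mathcal G$ on $\{1,\dots,N\}$, and let $P=(p_{ij})\in\mathbb R^{N\times N}$ be an average consensus matrix of $\mathcal G$: $P$ is symmetric with non-negative entries, $P\mathbf 1=\mathbf 1$, for $i\ne j$ one has $p_{ij}>0$ if and only if $\{i,j\}$ is an edge, and either $p_{ii}>0$ for some $i$ or $\mathcal G$ is not bipartite (so that $P^k\to\frac1N\mathbf 1\mathbf 1^T$). Norms are Euclidean for vectors and Frobenius for matrices, and $A\le B$ means $u^TAu\le u^TBu$ for all $u$. Let $f_1,\dots,f_N:\mathbb R^n\to\mathbb R$, $\overline f=\frac1N\sum_i f_i$, and let $x^*$ be the minimizer of $\overline f$. Choose, the same way for all $i$, one of $h_i(x)=\nabla^2f_i(x)$, $h_i(x)=\mathrm{diag}[\nabla^2 f_i(x)]$, or $h_i(x)=I$, and set $g_i(x)=h_i(x)x-\nabla f_i(x)$. For $\mathbf x=(x_1,\dots,x_N)\in\mathbb R^{nN}$ put $\overline h(\mathbf x)=\frac1N\sum_ih_i(x_i)$ and $\overline g(\mathbf x)=\frac1N\sum_ig_i(x_i)$. Denote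 by $h_i',g_i',\overline{h'},\overline{g'}$ the same objects built from the translated costs $f_i'(x)=f_i(x+x^*)$, and let $\psi(\mathbf x)=\overline{h'}(\mathbf x)^{-1}\,\overline{g'}(\mathbf x)$. **Assumption 1.** The $f_i$ are of class $C^3$, and there are $c,m>0$ with $cI\le\nabla^2\overline f(x)\le mI$ for all $x\in\mathbb R^n$. **Assumption 2.** There are $m_g,a_g,a_h,a_\psi>0$ such that, for all $x,x'\in\mathbb R^n$, all $\mathbf x,\mathbf x'\in\mathbb R^{nN}$ and all $i$: $cI\le\overline{h'}(\mathbf x)\le mI$; $\|\overline{g'}(\mathbf x)\|\le m_g$; $\|g_i'(x)-g_i'(x')\|\le a_g\|x-x'\|$; $\|h_i'(x)-h_i'(x')\|\le a_h\|x-x'\|$; $\|\psi(\mathbf x)-\psi(\mathbf x')\|\le a_\psi\|\mathbf x-\mathbf x'\|$. **Algorithm (Newton-Raphson Consensus).** For $z\in\mathbb R^{n\times n}$ let $[z]_c=z$ if $z\ge\frac c2I$ and $[z]_c=\frac c2I$ otherwise. The state is $s=(v_i,w_i,y_i,z_i,x_i)_{i=1}^N$ with $v_i,y_i,x_i\in\mathbb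 R^n$ and $w_i,z_i\in\mathbb R^{n\times n}$ ($v_i,w_i$ being registers for the previous values of $g_i(x_i)$, $h_i(x_i)$), and for $k\ge1$ $$\begin{aligned} x_i(k)&=(1-\varepsilon)x_i(k-1)+\varepsilon\,[z_i(k-1)]_c^{-1}y_i(k-1),\\ y_i(k)&=\sum_jp_{ij}\big(y_j(k-1)+g_j(x_j(k-1))-v_j(k-1)\big),\qquad v_i(k)=g_i(x_i(k-1)),\\ z_i(k)&=\sum_jp_{ij}\big(z_j(k-1)+h_j(x_j(k-1))-w_j(k-1)\big),\qquad w_i(k)=h_i(x_i(k-1)). \end{aligned}$$ The initial state is arbitrary. Let $\xi^y=\frac1N\sum_i(y_i(0)-v_i(0))$ and $\xi^z=\frac1N\sum_i(z_i(0)-w_i(0))$. **Theorem.** Under Assumptions 1 and 2 there is $\overline\varepsilon\in(0,1]$ such that the following hold for every $\varepsilon\in(0,\overline\varepsilon)$. 1. The algorithm is the forward-Euler discretization, with step $\varepsilon$, of the continuous-time system (where $K=I-P$ acts on the agent index) $$\varepsilon\dot v=-v+g(x),\quad \varepsilon\dot w=-w+h(x),\quad \varepsilon\dot y=-Ky+(I-K)(g(x)-v),\quad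 \varepsilon\dot z=-Kz+(I-K)(h(x)-w),\quad \dot x_i=-x_i+[z_i]_c^{-1}y_i .$$ 2. Let $s^*$ be the state with $v_i=g_i(x^*)$, $w_i=h_i(x^*)$, $y_i=\overline g(x^*,\dots,x^*)$, $z_i=\overline h(x^*,\dots,x^*)$, $x_i=x^*$ for all $i$. On the set of initial states with $\xi^y=0$ and $\xi^z=0$, to which $s^*$ belongs, $s^*$ is a globally exponentially stable equilibrium of the continuous-time system: there are $\alpha,\lambda>0$ such that every Carathéodory solution on an interval $[0,T]$ starting in this set satisfies $\|s(t)-s^*\|\le\alpha e^{-\lambda t}\|s(0)-s^*\|$ for $t\in[0,T]$. 3. On the same set, $s^*$ is a globally exponentially stable equilibrium of the algorithm: there are $\alpha>0$ and $r\in(0,1)$ with $\|s(k)-s^*\|\le\alpha r^k\|s(0)-s^*\|$ for all $k$ and all such $s(0)$. 4. Consequently, there is $r\in(0,1)$ such that for all initial states with $\xi^y=0$ and $\xi^z=0$ (in particular for all $x_i(0)\in\mathbb R^n$) and for every $i$, the local estimates converge exponentially to the global minimizer: $\|x_i(k)-x^*\|\le C r^k$ for all $k$, with $C$ depending on the initial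 state, and $\lim_{k\to\infty}x_i(k)=x^*$. -/

import Mathlib

open scoped Matrix.Norms.Frobenius

namespace NRC

noncomputable section

/-- `ℝⁿ` with the Euclidean norm. -/
abbrev Vec (n : ℕ) : Type := EuclideanSpace ℝ (Fin n)

/-- Real `n × n` matrices; their norm `‖A‖` is the Frobenius norm throughout. -/
abbrev Mat (n : ℕ) : Type := Matrix (Fin n) (Fin n) ℝ

/-- The matrix-vector product on Euclidean space. -/
def mulVec {n : ℕ} (A : Mat n) (u : Vec n) : Vec n := Matrix.toEuclideanLin A u

/-- The average `N⁻¹ ∑ i, a i` of a family indexed by the `N` agents. -/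
def avg {N : ℕ} {E : Type*} [AddCommGroup E] [Module ℝ E] (a : Fin N → E) : E :=
  (N : ℝ)⁻¹ • ∑ i, a i

/-- `A ≤ B` as quadratic forms, `uᵀ A u ≤ uᵀ B u` for all `u`. For symmetric matrices this is
the Loewner order (see `quadLE_iff_posSemidef`). -/
def QuadLE {n : ℕ} (A B : Mat n) : Prop :=
  ∀ u : Vec n, inner ℝ u (mulVec A u) ≤ inner ℝ u (mulVec B u)

theorem quadLE_iff_posSemidef {n : ℕ} {A B : Mat n} (hA : A.IsHermitian) (hB : B.IsHermitian) :
    QuadLE A B ↔ (B - A).PosSemidef := by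
  rw [Matrix.posSemidef_iff_dotProduct_mulVec]
  constructor
  · intro h
    refine ⟨hB.sub hA, fun x => ?_⟩
    have := h (WithLp.toLp 2 x)
    simp only [mulVec, Matrix.toLpLin_apply, EuclideanSpace.inner_eq_star_dotProduct] at this
    rw [Matrix.sub_mulVec, dotProduct_sub, sub_nonneg, dotProduct_comm (star x),
      dotProduct_comm (star x)]
    exact this
  · rintro ⟨-, h⟩ u
    have := h u.ofLp
    rw [Matrix.sub_mulVec, dotProduct_sub, sub_nonneg, dotProduct_comm (star u.ofLp),
      dotProduct_comm (star u.ofLp)] at this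
    simpa only [mulVec, Matrix.toLpLin_apply, EuclideanSpace.inner_eq_star_dotProduct] using this

/-! ### Costs -/

/-- The Hessian matrix, `(∇² f(x))_{ab} = ∂_a ∂_b f(x)`. -/
def hessian {n : ℕ} (f : Vec n → ℝ) (x : Vec n) : Mat n :=
  Matrix.of fun a b =>
    fderiv ℝ (fderiv ℝ f) x (EuclideanSpace.single a 1) (EuclideanSpace.single b 1)

/-- The global cost `f̄ = N⁻¹ ∑ i, f i`. -/
def globalCost {N n : ℕ} (f : Fin N → Vec n → ℝ) (x : Vec n) : ℝ :=
  avg fun i => f i x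

/-- The translated costs `f'_i(x) = f_i(x + x*)`. -/
def translate {N n : ℕ} (f : Fin N → Vec n → ℝ) (xs : Vec n) : Fin N → Vec n → ℝ :=
  fun i x => f i (x + xs)

/-- The three choices of the local curvature `h_i`. -/
inductive Curvature
  | newton
  | jacobi
  | gradient

/-- `h_i(x)` built from the cost `φ = f_i`: the Hessian, its diagonal part, or the identity. -/
def hLoc {n : ℕ} (κ : Curvature) (φ : Vec n → ℝ) (x : Vec n) : Mat n :=
  match κ with
  | .newton => hessian φ x
  | .jacobi => Matrix.diagonal (hessian φ x).diag
  | .gradient => 1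

/-- `g_i(x) = h_i(x) x - ∇ f_i(x)`, built from the cost `φ = f_i`. -/
def gLoc {n : ℕ} (κ : Curvature) (φ : Vec n → ℝ) (x : Vec n) : Vec n :=
  mulVec (hLoc κ φ x) x - gradient φ x

/-- `h̄(𝐱) = N⁻¹ ∑ i, h_i(x_i)`. -/
def hBar {N n : ℕ} (κ : Curvature) (f : Fin N → Vec n → ℝ) (x : Fin N → Vec n) : Mat n :=
  avg fun i => hLoc κ (f i) (x i)

/-- `ḡ(𝐱) = N⁻¹ ∑ i, g_i(x_i)`. -/
def gBar {N n : ℕ} (κ : Curvature) (f : Fin N → Vec n → ℝ) (x : Fin N → Vec n) : Vec n :=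
  avg fun i => gLoc κ (f i) (x i)

/-- `ψ(𝐱) = h̄(𝐱)⁻¹ ḡ(𝐱)`. -/
def psi {N n : ℕ} (κ : Curvature) (f : Fin N → Vec n → ℝ) (x : Fin N → Vec n) : Vec n :=
  mulVec (hBar κ f x)⁻¹ (gBar κ f x)

/-! ### Assumptions -/

/-- Convexity assumption: the local costs are `C³`, and `0 < c I ≤ ∇² f̄(x) ≤ m I` for all `x`. -/
structure ConvexityAssumption {N n : ℕ} (f : Fin N → Vec n → ℝ) (c m : ℝ) : Prop where
  smooth : ∀ i, ContDiff ℝ 3 (f i)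
  c_pos : 0 < c
  m_pos : 0 < m
  lower : ∀ x, QuadLE (c • (1 : Mat n)) (hessian (globalCost f) x)
  upper : ∀ x, QuadLE (hessian (globalCost f) x) (m • (1 : Mat n))

/-- The global bounds and Lipschitz conditions, for a family `f` of local costs (to be applied to
the translated costs). -/
def GlobalProperties {N n : ℕ} (κ : Curvature) (f : Fin N → Vec n → ℝ) (c m : ℝ) : Prop :=
  ∃ mg ag ah aψ : ℝ, 0 < mg ∧ 0 < ag ∧ 0 < ah ∧ 0 < aψ ∧
    (∀ x : Fin N → Vec n,
      QuadLE (c • (1 : Mat n)) (hBar κ f x) ∧ QuadLE (hBar κ f x) (m • (1 : Mat n))) ∧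
    (∀ x : Fin N → Vec n, ‖gBar κ f x‖ ≤ mg) ∧
    (∀ i, ∀ x x' : Vec n, ‖gLoc κ (f i) x - gLoc κ (f i) x'‖ ≤ ag * ‖x - x'‖) ∧
    (∀ i, ∀ x x' : Vec n, ‖hLoc κ (f i) x - hLoc κ (f i) x'‖ ≤ ah * ‖x - x'‖) ∧
    (∀ x x' : Fin N → Vec n,
      ‖psi κ f x - psi κ f x'‖ ≤ aψ * √(∑ i, ‖x i - x' i‖ ^ 2))

/-- `P` is an average consensus matrix of the undirected connected graph `G`: stochastic,
symmetric, and with positive weight on an off-diagonal pair exactly when it is an edge. Agents may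
put weight on themselves; the last field says that the graph of positive entries of `P`, with its
loops, is not bipartite, without which the powers of `P` do not converge. -/
structure IsAverageConsensus {N : ℕ} (G : SimpleGraph (Fin N)) (P : Matrix (Fin N) (Fin N) ℝ) :
    Prop where
  connected : G.Connected
  nonneg : ∀ i j, 0 ≤ P i j
  row_sum : ∀ i, ∑ j, P i j = 1
  symm : P.IsSymm
  support : ∀ i j, i ≠ j → (0 < P i j ↔ G.Adj i j)
  aperiodic : (∃ i, 0 < P i i) ∨ ¬ G.IsBipartite

/-! ### The algorithm -/

/-- The state of the network. The registers `v`, `w` hold the previous values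
`g_i(x_i(k-1))` and `h_i(x_i(k-1))`. -/
@[ext]
structure State (N n : ℕ) where
  v : Fin N → Vec n
  w : Fin N → Mat n
  y : Fin N → Vec n
  z : Fin N → Mat n
  x : Fin N → Vec n

open Classical in
/-- The thresholding `[z]_c`: `z` if `z ≥ (c/2) I`, and `(c/2) I` otherwise. -/
def thresh {n : ℕ} (c : ℝ) (z : Mat n) : Mat n :=
  if QuadLE ((c / 2) • (1 : Mat n)) z then z else (c / 2) • (1 : Mat n)

/-- One iteration of Newton-Raphson Consensus with step size `ε`. -/
def step {N n : ℕ} (κ : Curvature) (f : Fin N → Vec n → ℝ) (P : Matrix (Fin N) (Fin N) ℝ)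
    (c ε : ℝ) (s : State N n) : State N n where
  v i := gLoc κ (f i) (s.x i)
  w i := hLoc κ (f i) (s.x i)
  y i := ∑ j, P i j • (s.y j + gLoc κ (f j) (s.x j) - s.v j)
  z i := ∑ j, P i j • (s.z j + hLoc κ (f j) (s.x j) - s.w j)
  x i := (1 - ε) • s.x i + ε • mulVec (thresh c (s.z i))⁻¹ (s.y i)

/-- The state after `k` iterations from the initial state `s₀`. -/
def run {N n : ℕ} (κ : Curvature) (f : Fin N → Vec n → ℝ) (P : Matrix (Fin N) (Fin N) ℝ)
    (c ε : ℝ) (s₀ : State N n) (k : ℕ) : State N n :=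
  (step κ f P c ε)^[k] s₀

/-- `ξ^y = N⁻¹ ∑ i, (y_i(0) - g_i(x_i(-1)))`. -/
def xiY {N n : ℕ} (s₀ : State N n) : Vec n := avg fun i => s₀.y i - s₀.v i

/-- `ξ^z = N⁻¹ ∑ i, (z_i(0) - h_i(x_i(-1)))`. -/
def xiZ {N n : ℕ} (s₀ : State N n) : Mat n := avg fun i => s₀.z i - s₀.w i

/-- The states with vanishing perturbations. -/
def unperturbed (N n : ℕ) : Set (State N n) := {s | xiY s = 0 ∧ xiZ s = 0}

/-! ### The continuous-time system and stability -/

/-- The zero state. -/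
instance {N n : ℕ} : Zero (State N n) := ⟨⟨0, 0, 0, 0, 0⟩⟩

/-- The right-hand side of the continuous-time system, with `K = I - P`:
`ε v̇ = -v + g(x)`, `ε ẇ = -w + h(x)`, `ε ẏ = -K y + (I - K) (g(x) - v)`,
`ε ż = -K z + (I - K) (h(x) - w)`, `ẋ = -x + [z]_c⁻¹ y`. -/
def field {N n : ℕ} (κ : Curvature) (f : Fin N → Vec n → ℝ) (P : Matrix (Fin N) (Fin N) ℝ)
    (c ε : ℝ) (s : State N n) : State N n where
  v i := ε⁻¹ • (-s.v i + gLoc κ (f i) (s.x i))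
  w i := ε⁻¹ • (-s.w i + hLoc κ (f i) (s.x i))
  y i := ε⁻¹ • (-(∑ j, (1 - P) i j • s.y j) + ∑ j, P i j • (gLoc κ (f j) (s.x j) - s.v j))
  z i := ε⁻¹ • (-(∑ j, (1 - P) i j • s.z j) + ∑ j, P i j • (hLoc κ (f j) (s.x j) - s.w j))
  x i := -s.x i + mulVec (thresh c (s.z i))⁻¹ (s.y i)

/-- One forward-Euler step of length `ε` for `ṡ = F(s)`: `s + ε F(s)`. -/
def eulerStep {N n : ℕ} (F : State N n → State N n) (ε : ℝ) (s : State N n) : State N n where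
  v := s.v + ε • (F s).v
  w := s.w + ε • (F s).w
  y := s.y + ε • (F s).y
  z := s.z + ε • (F s).z
  x := s.x + ε • (F s).x

/-- The Euclidean distance of two states. -/
def stateDist {N n : ℕ} (s t : State N n) : ℝ :=
  √(∑ i, (‖s.v i - t.v i‖ ^ 2 + ‖s.w i - t.w i‖ ^ 2 + ‖s.y i - t.y i‖ ^ 2
    + ‖s.z i - t.z i‖ ^ 2 + ‖s.x i - t.x i‖ ^ 2))

/-- `u` is an integral of `φ` on `[0, T]`: `u(t) = u(0) + ∫₀ᵗ φ`. -/
def IsIntegralOn {E : Type*} [NormedAddCommGroup E] [NormedSpace ℝ E] (u φ : ℝ → E) (T : ℝ) :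
    Prop :=
  IntervalIntegrable φ MeasureTheory.volume 0 T ∧
    ∀ t ∈ Set.Icc 0 T, u t = u 0 + ∫ τ in (0 : ℝ)..t, φ τ

/-- `s` is a Carathéodory solution of `ṡ = F(s)` on `[0, T]`; the weak notion is used because
the thresholding makes the right-hand side discontinuous. Every `C¹` solution is one. -/
structure IsSolution {N n : ℕ} (F : State N n → State N n) (s : ℝ → State N n) (T : ℝ) :
    Prop where
  v : ∀ i, IsIntegralOn (fun t => (s t).v i) (fun t => (F (s t)).v i) T
  w : ∀ i, IsIntegralOn (fun t => (s t).w i) (fun t => (F (s t)).w i) T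
  y : ∀ i, IsIntegralOn (fun t => (s t).y i) (fun t => (F (s t)).y i) T
  z : ∀ i, IsIntegralOn (fun t => (s t).z i) (fun t => (F (s t)).z i) T
  x : ∀ i, IsIntegralOn (fun t => (s t).x i) (fun t => (F (s t)).x i) T

/-- `e` is a globally exponentially stable equilibrium of `ṡ = F(s)` on the set `S` of initial
states. -/
def ContinuousGES {N n : ℕ} (F : State N n → State N n) (S : Set (State N n)) (e : State N n) :
    Prop :=
  e ∈ S ∧ F e = 0 ∧ ∃ α l : ℝ, 0 < α ∧ 0 < l ∧ ∀ (T : ℝ) (s : ℝ → State N n),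
    IsSolution F s T → s 0 ∈ S → ∀ t ∈ Set.Icc 0 T,
      stateDist (s t) e ≤ α * Real.exp (-l * t) * stateDist (s 0) e

/-- `e` is a globally exponentially stable equilibrium of `s(k+1) = A(s(k))` on the set `S` of
initial states. -/
def DiscreteGES {N n : ℕ} (A : State N n → State N n) (S : Set (State N n)) (e : State N n) :
    Prop :=
  e ∈ S ∧ A e = e ∧ ∃ α r : ℝ, 0 < α ∧ 0 < r ∧ r < 1 ∧ ∀ s₀ ∈ S, ∀ k : ℕ,
    stateDist (A^[k] s₀) e ≤ α * r ^ k * stateDist s₀ e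

/-- The state in which all agents sit at `p` and the consensus variables have converged:
`v_i = g_i(p)`, `w_i = h_i(p)`, `y_i = ḡ(p, …, p)`, `z_i = h̄(p, …, p)`, `x_i = p`. -/
def consensusState {N n : ℕ} (κ : Curvature) (f : Fin N → Vec n → ℝ) (p : Vec n) :
    State N n where
  v i := gLoc κ (f i) p
  w i := hLoc κ (f i) p
  y _ := gBar κ f fun _ => p
  z _ := hBar κ f fun _ => p
  x _ := p

end

end NRC

namespace NRC

/-! ### Averages and the Euclidean norm over the agents -/

/-! Centred at the minimizer `xs`, the algorithm is a two-time-scale system. The fast variables are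
the registers (v_i, w_i) and the consensus variables (y_i, z_i). Since `P` is doubly stochastic, avg
y - avg v and avg z - avg w are conserved. When they vanish, (y_i, z_i) track the averages of the
local signals G_i = (g_i, h_i), with the factor ρ < 1 by which `P` contracts disagreements
(`exists_contracts_real`). The slow variables x_i move at speed ε towards [z_i]_c⁻¹ y_i. That point
differs from ψ(x) by at most a multiple of the tracking error (`norm_thresh_inv_mulVec_sub_le`):
where the threshold acts, z_i is already at distance c/2 from h̄, so its discontinuity is harmless.
When all agents agree, ψ(x) - x = -h̄⁻¹ ∇f̄ is a descent direction.

The Lyapunov function is U(avg x) + ν |x - avg x| + μ (|v - G(x)| + |y - avg v|), where v, y stand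
for the pairs and U = √(f̄ - f̄(x*)). Because of the square root every term is Lipschitz and
comparable to a norm, so all couplings are first-order terms given by the triangle inequality.
Disagreement perturbs the descent of U through the Lipschitz constant of ψ, which a large ν absorbs.
The motion of x shifts the tracked signals, which a small μ absorbs. Tracking errors perturb x,
which a small ε absorbs, since the fast part decays at a rate without the factor ε. This is
`TwoTimeScale.exists_lyap_le`; `QuadraticBounds.sqrt_step_le` supplies the descent of U.

One estimate serves both kinds of time. An `ApproxStep` advances the fast variables by θ and the
slow ones by ε θ, up to an error η. The algorithm is the case θ = 1, η = 0. The flow over a short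
time τ is the case θ = τ / ε with η as small as desired, which bounds a right Dini derivative, and
Grönwall concludes (`TwoTimeScale.lyap_le_exp`). -/

theorem avg_add {N : ℕ} {E : Type*} [AddCommGroup E] [Module ℝ E] (a b : Fin N → E) :
    avg (fun i => a i + b i) = avg a + avg b := by
  simp only [avg, Finset.sum_add_distrib, smul_add]

theorem avg_sub {N : ℕ} {E : Type*} [AddCommGroup E] [Module ℝ E] (a b : Fin N → E) :
    avg (fun i => a i - b i) = avg a - avg b := by
  simp only [avg, Finset.sum_sub_distrib, smul_sub]

theorem avg_smul {N : ℕ} {E : Type*} [AddCommGroup E] [Module ℝ E] (t : ℝ) (a : Fin N → E) :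
    avg (fun i => t • a i) = t • avg a := by
  simp only [avg, ← Finset.smul_sum, smul_comm t]

theorem avg_const {N : ℕ} [NeZero N] {E : Type*} [AddCommGroup E] [Module ℝ E] (e : E) :
    avg (fun _ : Fin N => e) = e := by
  have : (N : ℝ) ≠ 0 := Nat.cast_ne_zero.2 (NeZero.ne N)
  simp only [avg, Finset.sum_const, Finset.card_univ, Fintype.card_fin, ← Nat.cast_smul_eq_nsmul ℝ,
    smul_smul, inv_mul_cancel₀ this, one_smul]

theorem map_avg {N : ℕ} {E F : Type*} [AddCommGroup E] [Module ℝ E] [AddCommGroup F] [Module ℝ F]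
    (l : E →ₗ[ℝ] F) (a : Fin N → E) : l (avg a) = avg fun i => l (a i) := by
  simp only [avg, map_smul, map_sum]

/-- The Euclidean norm of a family of vectors indexed by the agents. -/
noncomputable def nrm {N : ℕ} {E : Type*} [NormedAddCommGroup E] (u : Fin N → E) : ℝ :=
  ‖(WithLp.toLp 2 u : PiLp 2 fun _ : Fin N => E)‖

section nrm

variable {N : ℕ} {E : Type*} [NormedAddCommGroup E]

theorem nrm_nonneg (u : Fin N → E) : 0 ≤ nrm u := norm_nonneg _

theorem nrm_eq_sqrt (u : Fin N → E) : nrm u = √(∑ i, ‖u i‖ ^ 2) := PiLp.norm_eq_of_L2 _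

theorem nrm_sq (u : Fin N → E) : nrm u ^ 2 = ∑ i, ‖u i‖ ^ 2 := PiLp.norm_sq_eq_of_L2 _ _

theorem nrm_add_le (u v : Fin N → E) : nrm (fun i => u i + v i) ≤ nrm u + nrm v :=
  norm_add_le (WithLp.toLp 2 u : PiLp 2 fun _ : Fin N => E) (WithLp.toLp 2 v)

theorem nrm_sub_le (u v : Fin N → E) : nrm (fun i => u i - v i) ≤ nrm u + nrm v :=
  norm_sub_le (WithLp.toLp 2 u : PiLp 2 fun _ : Fin N => E) (WithLp.toLp 2 v)

theorem nrm_smul [NormedSpace ℝ E] {t : ℝ} (ht : 0 ≤ t) (u : Fin N → E) :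
    nrm (fun i => t • u i) = t * nrm u := by
  have := norm_smul t (WithLp.toLp 2 u : PiLp 2 fun _ : Fin N => E)
  rw [Real.norm_of_nonneg ht] at this
  exact this

theorem norm_le_nrm (u : Fin N → E) (i : Fin N) : ‖u i‖ ≤ nrm u :=
  PiLp.norm_apply_le (WithLp.toLp 2 u : PiLp 2 fun _ : Fin N => E) i

theorem nrm_mono {F : Type*} [NormedAddCommGroup F] {u : Fin N → E} {v : Fin N → F}
    (h : ∀ i, ‖u i‖ ≤ ‖v i‖) : nrm u ≤ nrm v := by
  rw [nrm_eq_sqrt, nrm_eq_sqrt]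
  exact Real.sqrt_le_sqrt (Finset.sum_le_sum fun i _ => by gcongr; exact h i)

theorem nrm_le_mul {F : Type*} [NormedAddCommGroup F] {u : Fin N → E} {v : Fin N → F} {C : ℝ}
    (hC : 0 ≤ C) (h : ∀ i, ‖u i‖ ≤ C * ‖v i‖) : nrm u ≤ C * nrm v := by
  refine (nrm_mono (v := fun i => C • ‖v i‖) fun i => ?_).trans_eq ?_
  · rw [norm_smul, norm_norm, Real.norm_of_nonneg hC]
    exact h i
  · rw [nrm_smul hC]
    simp only [nrm_eq_sqrt, norm_norm]

theorem nrm_le_of_forall_le {u : Fin N → E} {r : ℝ} (hr : 0 ≤ r) (h : ∀ i, ‖u i‖ ≤ r) :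
    nrm u ≤ √N * r := by
  rw [nrm_eq_sqrt, ← Real.sqrt_sq hr, ← Real.sqrt_mul (Nat.cast_nonneg N)]
  refine Real.sqrt_le_sqrt ?_
  calc ∑ i, ‖u i‖ ^ 2 ≤ ∑ _i : Fin N, r ^ 2 := Finset.sum_le_sum fun i _ => by gcongr; exact h i
    _ = N * r ^ 2 := by simp

theorem continuous_nrm : Continuous fun u : Fin N → E => nrm u :=
  (PiLp.continuous_toLp 2 _).norm

/-- Cauchy–Schwarz over the agents; `E` needs no inner product. -/
theorem nrm_const_avg_le [NormedSpace ℝ E] (u : Fin N → E) :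
    nrm (fun _ : Fin N => avg u) ≤ nrm u := by
  refine abs_le_of_sq_le_sq' ?_ (nrm_nonneg u) |>.2
  rw [nrm_sq, nrm_sq]
  simp only [Finset.sum_const, Finset.card_univ, Fintype.card_fin, nsmul_eq_mul]
  rcases Nat.eq_zero_or_pos N with rfl | hN
  · simp
  have hN' : (0 : ℝ) < N := Nat.cast_pos.2 hN
  have h1 : ‖avg u‖ ≤ (N : ℝ)⁻¹ * ∑ i, ‖u i‖ := by
    rw [avg, norm_smul, Real.norm_of_nonneg (by positivity)]
    gcongr
    exact norm_sum_le _ _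
  have h2 : (∑ i, ‖u i‖) ^ 2 ≤ N * ∑ i, ‖u i‖ ^ 2 := by
    simpa using sq_sum_le_card_mul_sum_sq (s := Finset.univ) (f := fun i => ‖u i‖)
  calc (N : ℝ) * ‖avg u‖ ^ 2 ≤ N * ((N : ℝ)⁻¹ * ∑ i, ‖u i‖) ^ 2 := by gcongr
    _ = (N : ℝ)⁻¹ * (∑ i, ‖u i‖) ^ 2 := by field_simp
    _ ≤ (N : ℝ)⁻¹ * (N * ∑ i, ‖u i‖ ^ 2) := by gcongr
    _ = ∑ i, ‖u i‖ ^ 2 := by field_simp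

theorem norm_avg_le [NeZero N] [NormedSpace ℝ E] (u : Fin N → E) : ‖avg u‖ ≤ nrm u :=
  (norm_le_nrm (fun _ : Fin N => avg u) 0).trans (nrm_const_avg_le u)

end nrm

/-! ### Contraction of the consensus matrix on disagreements -/

/-- `P` contracts the disagreement of families with values in `E` by the factor `ρ`. -/
def Contracts {N : ℕ} (P : Matrix (Fin N) (Fin N) ℝ) (ρ : ℝ) (E : Type*) [NormedAddCommGroup E]
    [NormedSpace ℝ E] : Prop :=
  ∀ u : Fin N → E, ∑ i, ‖∑ j, P i j • u j - avg u‖ ^ 2 ≤ ρ ^ 2 * ∑ i, ‖u i‖ ^ 2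

theorem Contracts.nrm_le {N : ℕ} {P : Matrix (Fin N) (Fin N) ℝ} {ρ : ℝ} (hρ : 0 ≤ ρ) {E : Type*}
    [NormedAddCommGroup E] [NormedSpace ℝ E] (h : Contracts P ρ E) (u : Fin N → E) :
    nrm (fun i => ∑ j, P i j • u j - avg u) ≤ ρ * nrm u := by
  rw [nrm_eq_sqrt, nrm_eq_sqrt, ← Real.sqrt_sq hρ, ← Real.sqrt_mul (sq_nonneg _)]
  exact Real.sqrt_le_sqrt (h u)

/-- `P` acts on the agent index only, so the scalar contraction can be summed over coordinates in
which the norm is Euclidean. -/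
theorem Contracts.of_coordinates {N : ℕ} {P : Matrix (Fin N) (Fin N) ℝ} {ρ : ℝ}
    (h : Contracts P ρ ℝ) {E ι : Type*} [Fintype ι] [NormedAddCommGroup E] [NormedSpace ℝ E]
    (l : ι → E →ₗ[ℝ] ℝ) (hl : ∀ e, ‖e‖ ^ 2 = ∑ a, l a e ^ 2) : Contracts P ρ E := by
  intro u
  simp only [hl, map_sub, map_sum, map_smul, map_avg]
  rw [Finset.sum_comm, Finset.sum_comm (f := fun i a => l a (u i) ^ 2), Finset.mul_sum]
  refine Finset.sum_le_sum fun a _ => ?_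
  simpa only [Real.norm_eq_abs, sq_abs] using h fun i => l a (u i)

theorem Contracts.vec {N n : ℕ} {P : Matrix (Fin N) (Fin N) ℝ} {ρ : ℝ} (h : Contracts P ρ ℝ) :
    Contracts P ρ (Vec n) :=
  h.of_coordinates (fun a => (EuclideanSpace.proj a : Vec n →L[ℝ] ℝ).toLinearMap) fun e => by
    simp [EuclideanSpace.real_norm_sq_eq]

theorem norm_sq_mat {n : ℕ} (A : Mat n) : ‖A‖ ^ 2 = ∑ i, ∑ j, A i j ^ 2 := by
  rw [Matrix.frobenius_norm_def, ← Real.sqrt_eq_rpow, Real.sq_sqrt (by positivity)]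
  simp

theorem Contracts.mat {N n : ℕ} {P : Matrix (Fin N) (Fin N) ℝ} {ρ : ℝ} (h : Contracts P ρ ℝ) :
    Contracts P ρ (Mat n) :=
  h.of_coordinates (ι := Fin n × Fin n) (fun a => Matrix.entryLinearMap ℝ ℝ a.1 a.2) fun e => by
    simp [norm_sq_mat, Fintype.sum_prod_type]

theorem Contracts.prod {N : ℕ} {P : Matrix (Fin N) (Fin N) ℝ} {ρ : ℝ} {E F : Type*}
    [NormedAddCommGroup E] [NormedSpace ℝ E] [NormedAddCommGroup F] [NormedSpace ℝ F]
    (hE : Contracts P ρ E) (hF : Contracts P ρ F) : Contracts P ρ (WithLp 2 (E × F)) := by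
  intro u
  have h1 : ∀ v : Fin N → WithLp 2 (E × F), (∑ i, v i).fst = ∑ i, (v i).fst := fun v =>
    map_sum (WithLp.fstL 2 ℝ E F) v Finset.univ
  have h2 : ∀ v : Fin N → WithLp 2 (E × F), (∑ i, v i).snd = ∑ i, (v i).snd := fun v =>
    map_sum (WithLp.sndL 2 ℝ E F) v Finset.univ
  simp only [WithLp.prod_norm_sq_eq_of_L2, Finset.sum_add_distrib, mul_add]
  refine add_le_add ?_ ?_
  · simpa only [avg, WithLp.sub_fst, WithLp.smul_fst, h1] using hE fun i => (u i).fst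
  · simpa only [avg, WithLp.sub_snd, WithLp.smul_snd, h2] using hF fun i => (u i).snd

section IsAverageConsensus

variable {N : ℕ} {G : SimpleGraph (Fin N)} {P : Matrix (Fin N) (Fin N) ℝ}

theorem IsAverageConsensus.neZero (hP : IsAverageConsensus G P) : NeZero N :=
  ⟨by rintro rfl; exact hP.connected.nonempty.elim fun i => i.elim0⟩

theorem IsAverageConsensus.col_sum (hP : IsAverageConsensus G P) (j : Fin N) :
    ∑ i, P i j = 1 := by
  rw [← hP.row_sum j]
  exact Finset.sum_congr rfl fun i _ => hP.symm.apply j i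

theorem IsAverageConsensus.avg_mul (hP : IsAverageConsensus G P) {E : Type*} [AddCommGroup E]
    [Module ℝ E] (u : Fin N → E) : avg (fun i => ∑ j, P i j • u j) = avg u := by
  simp only [avg]
  rw [Finset.sum_comm]
  simp only [← Finset.sum_smul, hP.col_sum, one_smul]

/-- A function that agrees along edges of a connected graph is constant. -/
theorem eq_of_connected {V α : Type*} {G : SimpleGraph V} (hG : G.Connected) {u : V → α}
    (h : ∀ i j, G.Adj i j → u i = u j) (i j : V) : u i = u j := by
  obtain ⟨p⟩ := hG.preconnected i j
  induction p with
  | nil => rfl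
  | cons hadj _ ih => exact (h _ _ hadj).trans ih

/-- The equality case of |Pu| ≤ |u| on mean-zero vectors. It forces u to change sign along every
edge, which a loop or an odd cycle forbids unless u = 0. -/
theorem IsAverageConsensus.eq_zero_of_sum_sq_le (hP : IsAverageConsensus G P) {u : Fin N → ℝ}
    (hu : ∑ i, u i = 0) (h : ∑ i, u i ^ 2 ≤ ∑ i, (∑ j, P i j * u j) ^ 2) : u = 0 := by
  set q : Fin N → ℝ := fun i => ∑ j, P i j * u j with hq
  -- Row i of `P` is a probability vector under which u has mean `q i`. Summing the variances over i
  -- and using the column sums gives |u|² - |Pu|².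
  have hgap : ∑ i, ∑ j, P i j * (u j - q i) ^ 2 = ∑ i, u i ^ 2 - ∑ i, q i ^ 2 := by
    have h1 : ∀ i, ∑ j, P i j * (u j - q i) ^ 2 = ∑ j, P i j * u j ^ 2 - q i ^ 2 := by
      intro i
      calc ∑ j, P i j * (u j - q i) ^ 2
          = ∑ j, (P i j * u j ^ 2 - 2 * q i * (P i j * u j) + q i ^ 2 * P i j) :=
            Finset.sum_congr rfl fun j _ => by ring
        _ = ∑ j, P i j * u j ^ 2 - 2 * q i * q i + q i ^ 2 * 1 := by
            rw [Finset.sum_add_distrib, Finset.sum_sub_distrib, ← Finset.mul_sum,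
              ← Finset.mul_sum, hP.row_sum]
        _ = _ := by ring
    simp only [h1, Finset.sum_sub_distrib]
    rw [Finset.sum_comm]
    simp only [← Finset.sum_mul, hP.col_sum, one_mul]
  have hnn : ∀ i j, 0 ≤ P i j * (u j - q i) ^ 2 := fun i j =>
    mul_nonneg (hP.nonneg i j) (sq_nonneg _)
  have hz : ∑ i, ∑ j, P i j * (u j - q i) ^ 2 = 0 :=
    le_antisymm (by rw [hgap]; linarith) (Finset.sum_nonneg fun i _ =>
      Finset.sum_nonneg fun j _ => hnn i j)
  have hval : ∀ i j, 0 < P i j → u j = q i := by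
    intro i j hij
    have h1 := (Finset.sum_eq_zero_iff_of_nonneg fun i _ =>
      Finset.sum_nonneg fun j _ => hnn i j).1 hz i (Finset.mem_univ i)
    have h2 := (Finset.sum_eq_zero_iff_of_nonneg fun j _ => hnn i j).1 h1 j (Finset.mem_univ j)
    have h3 := (mul_eq_zero.1 h2).resolve_left hij.ne'
    exact sub_eq_zero.1 (pow_eq_zero_iff two_ne_zero |>.1 h3)
  have hpos : ∀ i j, G.Adj i j → 0 < P i j := fun i j hij => (hP.support i j hij.ne).2 hij
  have := hP.neZero
  -- Along an edge the values of u and q are swapped, so u + q is constant; both have zero sum, so q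
  -- = -u.
  have hconst : ∀ i j, u i + q i = u j + q j := eq_of_connected hP.connected fun i j hij => by
    rw [hval i j (hpos i j hij), hval j i (hpos j i hij.symm), add_comm]
  have hsumq : ∑ i, q i = 0 := by
    rw [← hu, hq, Finset.sum_comm]
    simp only [← Finset.sum_mul, hP.col_sum, one_mul]
  have hqu : ∀ i, q i = -u i := by
    intro i
    have h1 : ∑ j : Fin N, (u j + q j) = N * (u i + q i) := by
      rw [Finset.sum_congr rfl fun j _ => hconst j i]
      simp
      ring
    rw [Finset.sum_add_distrib, hu, hsumq, add_zero] at h1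
    have h2 := (mul_eq_zero.1 h1.symm).resolve_left (Nat.cast_ne_zero.2 (NeZero.ne N))
    linarith
  have habs : ∀ i j, |u i| = |u j| := eq_of_connected hP.connected fun i j hij => by
    rw [hval i j (hpos i j hij), hqu, abs_neg]
  by_contra hne
  obtain ⟨k, hk⟩ := Function.ne_iff.1 hne
  have hall : ∀ i, u i ≠ 0 := fun i => by
    rw [← abs_pos, habs i k]
    exact abs_pos.2 hk
  rcases hP.aperiodic with ⟨i, hi⟩ | hbip
  · have := hval i i hi
    rw [hqu] at this
    exact hall i (by linarith)
  · refine hbip ?_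
    classical
    -- The sign of u is a proper 2-colouring.
    let C : G.Coloring Bool := SimpleGraph.Coloring.mk (fun i => decide (0 < u i)) (by
      intro i j hij heq
      have h1 : u j = -u i := by rw [hval i j (hpos i j hij), hqu]
      have h2 : 0 < u i ↔ 0 < u j := by simpa using heq
      rw [h1] at h2
      rcases lt_or_gt_of_ne (hall i) with h3 | h3
      · have := h2.2 (by linarith)
        linarith
      · have := h2.1 h3
        linarith)
    simpa using C.colorable

/-- |Pu|² attains its maximum on the compact unit sphere of mean-zero vectors, and the equality case
makes this maximum less than 1. -/
theorem IsAverageConsensus.exists_contracts_real (hP : IsAverageConsensus G P) :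
    ∃ ρ : ℝ, 0 ≤ ρ ∧ ρ < 1 ∧ Contracts P ρ ℝ := by
  have := hP.neZero
  set F : (Fin N → ℝ) → ℝ := fun u => ∑ i, (∑ j, P i j * u j) ^ 2 with hF
  have hFc : Continuous F := by fun_prop
  have key : ∃ ρ : ℝ, 0 ≤ ρ ∧ ρ < 1 ∧ ∀ u : Fin N → ℝ, ∑ i, u i = 0 →
      F u ≤ ρ ^ 2 * ∑ i, u i ^ 2 := by
    set S : Set (Fin N → ℝ) := {u | ∑ i, u i = 0 ∧ ∑ i, u i ^ 2 = 1} with hS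
    have hSc : IsCompact S := by
      refine Metric.isCompact_of_isClosed_isBounded ?_ ?_
      · exact (isClosed_eq (by fun_prop) continuous_const).inter
          (isClosed_eq (by fun_prop) continuous_const)
      · refine (Metric.isBounded_closedBall (x := 0) (r := 1)).subset fun u hu => ?_
        rw [mem_closedBall_zero_iff, pi_norm_le_iff_of_nonneg zero_le_one]
        intro i
        rw [Real.norm_eq_abs, ← sq_le_one_iff_abs_le_one, ← hu.2]
        exact Finset.single_le_sum (f := fun i => u i ^ 2) (fun j _ => sq_nonneg _)
          (Finset.mem_univ i)
    have hscale : ∀ u : Fin N → ℝ, ∑ i, u i = 0 → u ≠ 0 →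
        ∃ w ∈ S, F u = F w * ∑ i, u i ^ 2 := by
      intro u hu hne
      obtain ⟨k, hk⟩ := Function.ne_iff.1 hne
      have hpos : 0 < ∑ i, u i ^ 2 := Finset.sum_pos' (fun i _ => sq_nonneg _)
        ⟨k, Finset.mem_univ k, by have : u k ≠ 0 := hk; positivity⟩
      set t := √(∑ i, u i ^ 2) with ht
      have htpos : 0 < t := Real.sqrt_pos.2 hpos
      have ht2 : t ^ 2 = ∑ i, u i ^ 2 := Real.sq_sqrt hpos.le
      refine ⟨fun i => t⁻¹ * u i, ⟨?_, ?_⟩, ?_⟩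
      · rw [← Finset.mul_sum, hu, mul_zero]
      · simp only [mul_pow, ← Finset.mul_sum]
        rw [← ht2]
        field_simp
      · rw [← ht2, hF]
        simp only
        rw [Finset.sum_mul]
        refine Finset.sum_congr rfl fun i _ => ?_
        have : ∑ j, P i j * (t⁻¹ * u j) = t⁻¹ * ∑ j, P i j * u j := by
          rw [Finset.mul_sum]
          exact Finset.sum_congr rfl fun j _ => by ring
        rw [this]
        field_simp
    -- The sphere is empty when there is a single agent.
    rcases S.eq_empty_or_nonempty with hE | hne
    · refine ⟨0, le_rfl, zero_lt_one, fun u hu => ?_⟩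
      by_cases h0 : u = 0
      · simp [h0, hF]
      · obtain ⟨w, hw, -⟩ := hscale u hu h0
        rw [hE] at hw
        exact hw.elim
    · obtain ⟨w, hw, hmax⟩ := hSc.exists_isMaxOn hne hFc.continuousOn
      have hF0 : 0 ≤ F w := Finset.sum_nonneg fun i _ => sq_nonneg _
      refine ⟨√(F w), Real.sqrt_nonneg _, ?_, fun u hu => ?_⟩
      · rw [Real.sqrt_lt' one_pos, one_pow]
        by_contra hge
        push Not at hge
        have := hP.eq_zero_of_sum_sq_le hw.1 (hw.2.trans_le hge)
        have h1 := hw.2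
        simp [this] at h1
      · rw [Real.sq_sqrt hF0]
        by_cases h0 : u = 0
        · simp [h0, hF]
        · obtain ⟨w', hw', h1⟩ := hscale u hu h0
          rw [h1]
          exact mul_le_mul_of_nonneg_right (hmax hw') (Finset.sum_nonneg fun i _ => sq_nonneg _)
  obtain ⟨ρ, h0, h1, h⟩ := key
  refine ⟨ρ, h0, h1, fun u => ?_⟩
  have hN : (N : ℝ) ≠ 0 := Nat.cast_ne_zero.2 (NeZero.ne N)
  have hsum : ∑ i, u i = N * avg u := by
    simp only [avg, smul_eq_mul]
    field_simp
  -- Rows sum to one, so Pu - avg u = P(u - avg u), and removing the mean does not increase the sum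
  -- of squares.
  have h2 := h (fun i => u i - avg u) (by
    rw [Finset.sum_sub_distrib, hsum]
    simp)
  have h3 : ∑ i, (u i - avg u) ^ 2 = ∑ i, u i ^ 2 - N * avg u ^ 2 := by
    calc ∑ i, (u i - avg u) ^ 2 = ∑ i, (u i ^ 2 - 2 * avg u * u i + avg u ^ 2) :=
          Finset.sum_congr rfl fun i _ => by ring
      _ = _ := by
          rw [Finset.sum_add_distrib, Finset.sum_sub_distrib, ← Finset.mul_sum, hsum]
          simp
          ring
  have h4 : ∀ i, ∑ j, P i j * (u j - avg u) = ∑ j, P i j • u j - avg u := by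
    intro i
    simp only [mul_sub, Finset.sum_sub_distrib, ← Finset.sum_mul, hP.row_sum, one_mul, smul_eq_mul]
  simp only [hF, h4, h3] at h2
  simp only [Real.norm_eq_abs, sq_abs]
  refine h2.trans ?_
  gcongr
  have : 0 ≤ (N : ℝ) * avg u ^ 2 := by positivity
  linarith

end IsAverageConsensus

/-! ### Strongly convex functions with a quadratic upper bound -/

section QuadraticBounds

variable {X : Type*} [NormedAddCommGroup X] [InnerProductSpace ℝ X]

/-- `φ` is a nonnegative function vanishing at the origin, `c`-strongly convex and `m`-smooth with
gradient `g`. -/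
structure QuadraticBounds (φ : X → ℝ) (g : X → X) (c m : ℝ) : Prop where
  c_pos : 0 < c
  m_pos : 0 < m
  nonneg : ∀ x, 0 ≤ φ x
  zero : φ 0 = 0
  lower : ∀ x d, φ x + inner ℝ (g x) d + c / 2 * ‖d‖ ^ 2 ≤ φ (x + d)
  upper : ∀ x d, φ (x + d) ≤ φ x + inner ℝ (g x) d + m / 2 * ‖d‖ ^ 2

variable {φ : X → ℝ} {g : X → X} {c m : ℝ}

/-- The displacement -g(x)/m minimizes the quadratic upper bound, whose value there is still
nonnegative. -/
theorem QuadraticBounds.norm_grad_sq_le (h : QuadraticBounds φ g c m) (x : X) :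
    ‖g x‖ ^ 2 ≤ 2 * m * φ x := by
  have h1 := (h.nonneg _).trans (h.upper x (-(m⁻¹ • g x)))
  have hm := h.m_pos
  rw [inner_neg_right, inner_smul_right, real_inner_self_eq_norm_sq, norm_neg, norm_smul,
    Real.norm_of_nonneg (by positivity)] at h1
  have h2 : φ x + -(m⁻¹ * ‖g x‖ ^ 2) + m / 2 * (m⁻¹ * ‖g x‖) ^ 2
      = (2 * m * φ x - ‖g x‖ ^ 2) / (2 * m) := by field_simp; ring
  rw [h2] at h1
  have := mul_nonneg h1 (by positivity : 0 ≤ 2 * m)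
  rw [div_mul_cancel₀ _ (by positivity)] at this
  linarith

theorem QuadraticBounds.grad_zero (h : QuadraticBounds φ g c m) : g 0 = 0 := by
  have := h.norm_grad_sq_le 0
  rw [h.zero, mul_zero] at this
  exact norm_eq_zero.1 (pow_eq_zero_iff two_ne_zero |>.1 (le_antisymm this (sq_nonneg _)))

/-- The gradient bound |g|² ≤ 2mφ is what is needed to complete the square in the quadratic upper
bound. -/
theorem QuadraticBounds.sqrt_add_le (h : QuadraticBounds φ g c m) (x d : X) :
    √(φ (x + d)) ≤ √(φ x) + √(m / 2) * ‖d‖ := by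
  have hm := h.m_pos
  refine Real.sqrt_le_iff.2 ⟨by positivity, (h.upper x d).trans ?_⟩
  have h1 : inner ℝ (g x) d ≤ 2 * (√(φ x) * (√(m / 2) * ‖d‖)) := by
    refine (real_inner_le_norm _ _).trans ?_
    rw [← mul_assoc, ← mul_assoc]
    gcongr
    refine abs_le_of_sq_le_sq' ?_ (by positivity) |>.2
    rw [mul_pow, mul_pow, Real.sq_sqrt (h.nonneg x), Real.sq_sqrt (by positivity)]
    linarith [h.norm_grad_sq_le x]
  rw [add_sq, mul_pow, Real.sq_sqrt (h.nonneg x), Real.sq_sqrt (by positivity)]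
  linarith

theorem QuadraticBounds.le_sqrt (h : QuadraticBounds φ g c m) (x : X) :
    √(c / 2) * ‖x‖ ≤ √(φ x) := by
  have hc := h.c_pos
  have := h.lower 0 x
  rw [h.grad_zero, h.zero, inner_zero_left, zero_add, zero_add, zero_add] at this
  refine Real.le_sqrt_of_sq_le ?_
  rwa [mul_pow, Real.sq_sqrt (by positivity)]

/-- The Polyak–Łojasiewicz inequality, from strong convexity evaluated at the minimizer 0. -/
theorem QuadraticBounds.le_norm_grad_sq (h : QuadraticBounds φ g c m) (x : X) :
    2 * c * φ x ≤ ‖g x‖ ^ 2 := by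
  have h1 := h.lower x (-x)
  have hc := h.c_pos
  rw [add_neg_cancel, h.zero, inner_neg_right, norm_neg] at h1
  have h2 := real_inner_le_norm (g x) x
  nlinarith [sq_nonneg (‖g x‖ - c * ‖x‖)]

/-- Decrease along a step in a direction `p` that makes an acute angle with the gradient. -/
theorem QuadraticBounds.sqrt_step_le (h : QuadraticBounds φ g c m) {x p : X} {δ : ℝ} (hδ : 0 ≤ δ)
    (hδ1 : δ ≤ (c / m) ^ 2) (hδ2 : δ ≤ m / c) (hp : ‖g x‖ ^ 2 ≤ m * inner ℝ (g x) p)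
    (hp' : c * ‖p‖ ≤ ‖g x‖) :
    √(φ (x + δ • (-p))) ≤ (1 - c / (2 * m) * δ) * √(φ x) := by
  have hc := h.c_pos
  have hm := h.m_pos
  have h1 := h.upper x (δ • (-p))
  rw [inner_smul_right, inner_neg_right, norm_smul, norm_neg, Real.norm_of_nonneg hδ] at h1
  have hb : 0 ≤ 1 - c / (2 * m) * δ := by
    have : c / (2 * m) * δ ≤ c / (2 * m) * (m / c) := by gcongr
    have h3 : c / (2 * m) * (m / c) = 1 / 2 := by field_simp
    linarith
  -- The bound δ ≤ (c/m)² limits the second-order term to half of the guaranteed first-order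
  -- decrease (δ/m)‖g x‖².
  have hd : m / 2 * (δ * ‖p‖) ^ 2 ≤ δ / (2 * m) * ‖g x‖ ^ 2 := by
    have h3 : (c * ‖p‖) ^ 2 ≤ ‖g x‖ ^ 2 := by gcongr
    calc m / 2 * (δ * ‖p‖) ^ 2 = m / 2 * δ * ‖p‖ ^ 2 * δ := by ring
      _ ≤ m / 2 * δ * ‖p‖ ^ 2 * (c / m) ^ 2 := by gcongr
      _ = δ / (2 * m) * (c * ‖p‖) ^ 2 := by field_simp
      _ ≤ _ := by gcongr
  have he : δ / m * ‖g x‖ ^ 2 ≤ δ * inner ℝ (g x) p := by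
    calc δ / m * ‖g x‖ ^ 2 ≤ δ / m * (m * inner ℝ (g x) p) := by gcongr
      _ = _ := by field_simp
  have hf : δ / (2 * m) * (2 * c * φ x) ≤ δ / (2 * m) * ‖g x‖ ^ 2 := by
    gcongr
    exact h.le_norm_grad_sq x
  refine Real.sqrt_le_iff.2 ⟨mul_nonneg hb (Real.sqrt_nonneg _), ?_⟩
  rw [mul_pow, Real.sq_sqrt (h.nonneg x)]
  have h5 : δ / m * ‖g x‖ ^ 2 = 2 * (δ / (2 * m) * ‖g x‖ ^ 2) := by field_simp
  have h6 : δ / (2 * m) * (2 * c * φ x) = 2 * (c / (2 * m) * δ) * φ x := by field_simp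
  -- With s = cδ/(2m), the decrease gives φ the factor 1 - 2s, which is at most (1 - s)².
  have h7 : 0 ≤ (c / (2 * m) * δ) ^ 2 * φ x := mul_nonneg (sq_nonneg _) (h.nonneg x)
  nlinarith

end QuadraticBounds

/-! ### Second-order Taylor bounds -/

/-- Two monotonicity arguments: p' - Mt decreases on the line, hence p - p'(0)t - Mt²/2 decreases on
[0, ∞). -/
theorem le_taylor_of_deriv2_le {p p' p'' : ℝ → ℝ} {M : ℝ} (h1 : ∀ t, HasDerivAt p (p' t) t)
    (h2 : ∀ t, HasDerivAt p' (p'' t) t) (hM : ∀ t, p'' t ≤ M) : p 1 ≤ p 0 + p' 0 + M / 2 := by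
  have hA : Antitone fun t => p' t - M * t := by
    refine antitone_of_hasDerivAt_nonpos (f' := fun t => p'' t - M * 1)
      (fun t => (h2 t).sub ((hasDerivAt_id t).const_mul M)) fun t => ?_
    simpa using hM t
  have hB : AntitoneOn (fun t => p t - p' 0 * t - M / 2 * t ^ 2) (Set.Ici 0) := by
    have hd : ∀ t, HasDerivAt (fun t => p t - p' 0 * t - M / 2 * t ^ 2)
        (p' t - p' 0 * 1 - M / 2 * (2 * t)) t := fun t => by
      have h3 := hasDerivAt_pow 2 t
      simp only [Nat.cast_ofNat, Nat.add_one_sub_one, pow_one] at h3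
      exact ((h1 t).sub ((hasDerivAt_id t).const_mul (p' 0))).sub (h3.const_mul (M / 2))
    refine antitoneOn_of_deriv_nonpos (convex_Ici 0)
      (fun t _ => (hd t).continuousAt.continuousWithinAt)
      (fun t _ => (hd t).differentiableAt.differentiableWithinAt) fun t ht => ?_
    rw [interior_Ici] at ht
    rw [(hd t).deriv]
    have := hA (le_of_lt ht)
    simp only at this
    linarith
  have := hB (Set.mem_Ici.2 le_rfl) (Set.mem_Ici.2 zero_le_one) zero_le_one
  simp only at this
  linarith

section Hessian

variable {n : ℕ}

theorem mulVec_apply (A : Mat n) (u : Vec n) (i : Fin n) : mulVec A u i = ∑ j, A i j * u j := by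
  simp [mulVec, Matrix.toLpLin_apply, Matrix.mulVec, dotProduct]

theorem sum_smul_single (u : Vec n) :
    ∑ a, u a • (EuclideanSpace.single a (1 : ℝ) : Vec n) = u := by
  ext i
  simp [Pi.single_apply]

theorem inner_mulVec_hessian (φ : Vec n → ℝ) (x u v : Vec n) :
    inner ℝ u (mulVec (hessian φ x) v) = fderiv ℝ (fderiv ℝ φ) x u v := by
  conv_rhs => rw [← sum_smul_single u, ← sum_smul_single v]
  simp only [map_sum, map_smul, FunLike.coe_sum, Finset.sum_apply, FunLike.coe_smul, Pi.smul_apply,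
    smul_eq_mul, Finset.mul_sum]
  rw [PiLp.inner_apply]
  refine (Finset.sum_congr rfl fun a _ => ?_).trans Finset.sum_comm
  rw [mulVec_apply]
  simp only [hessian, Matrix.of_apply, RCLike.inner_apply, conj_trivial, Finset.sum_mul]
  exact Finset.sum_congr rfl fun b _ => by ring

theorem hasDerivAt_line (φ : Vec n → ℝ) (hφ : Differentiable ℝ φ) (x d : Vec n) (t : ℝ) :
    HasDerivAt (fun t : ℝ => φ (x + t • d)) (fderiv ℝ φ (x + t • d) d) t := by
  have hl : HasDerivAt (fun t : ℝ => x + t • d) d t := by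
    simpa using ((hasDerivAt_id t).smul_const d).const_add x
  exact (hφ _).hasFDerivAt.comp_hasDerivAt t hl

theorem hasDerivAt_fderiv_line (φ : Vec n → ℝ) (hφ : ContDiff ℝ 2 φ) (x d : Vec n) (t : ℝ) :
    HasDerivAt (fun t : ℝ => fderiv ℝ φ (x + t • d) d)
      (fderiv ℝ (fderiv ℝ φ) (x + t • d) d d) t := by
  have hl : HasDerivAt (fun t : ℝ => x + t • d) d t := by
    simpa using ((hasDerivAt_id t).smul_const d).const_add x
  have hd : Differentiable ℝ (fderiv ℝ φ) :=
    (hφ.fderiv_right (m := 1) (by norm_num)).differentiable (by norm_num)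
  have h1 := (hd (x + t • d)).hasFDerivAt.comp_hasDerivAt t hl
  exact h1.clm_apply (hasDerivAt_const t d) |>.congr_deriv (by simp)

theorem inner_gradient_eq (φ : Vec n → ℝ) (x d : Vec n) :
    inner ℝ (gradient φ x) d = fderiv ℝ φ x d := by
  rw [gradient, InnerProductSpace.toDual_symm_apply]

theorem mulVec_smul_one (t : ℝ) (u : Vec n) : mulVec (t • (1 : Mat n)) u = t • u := by
  ext i
  simp [mulVec_apply, Matrix.one_apply]

theorem quadLE_smul_one_left {t : ℝ} {A : Mat n} :
    QuadLE (t • (1 : Mat n)) A ↔ ∀ u : Vec n, t * ‖u‖ ^ 2 ≤ inner ℝ u (mulVec A u) := by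
  simp only [QuadLE, mulVec_smul_one, inner_smul_right, real_inner_self_eq_norm_sq]

theorem quadLE_smul_one_right {t : ℝ} {A : Mat n} :
    QuadLE A (t • (1 : Mat n)) ↔ ∀ u : Vec n, inner ℝ u (mulVec A u) ≤ t * ‖u‖ ^ 2 := by
  simp only [QuadLE, mulVec_smul_one, inner_smul_right, real_inner_self_eq_norm_sq]

theorem le_taylor_of_hessian_le {φ : Vec n → ℝ} {m : ℝ} (hφ : ContDiff ℝ 2 φ)
    (h : ∀ x, QuadLE (hessian φ x) (m • (1 : Mat n))) (x d : Vec n) :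
    φ (x + d) ≤ φ x + inner ℝ (gradient φ x) d + m / 2 * ‖d‖ ^ 2 := by
  have := le_taylor_of_deriv2_le (hasDerivAt_line φ (hφ.differentiable (by norm_num)) x d)
    (hasDerivAt_fderiv_line φ hφ x d) (M := m * ‖d‖ ^ 2) fun t => by
      rw [← inner_mulVec_hessian]
      exact quadLE_smul_one_right.1 (h _) d
  simp only [one_smul, zero_smul, add_zero] at this
  rw [inner_gradient_eq]
  linarith

theorem taylor_le_of_le_hessian {φ : Vec n → ℝ} {c : ℝ} (hφ : ContDiff ℝ 2 φ)
    (h : ∀ x, QuadLE (c • (1 : Mat n)) (hessian φ x)) (x d : Vec n) :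
    φ x + inner ℝ (gradient φ x) d + c / 2 * ‖d‖ ^ 2 ≤ φ (x + d) := by
  -- The upper bound applied to -φ along the segment.
  have := le_taylor_of_deriv2_le
    (fun t => (hasDerivAt_line φ (hφ.differentiable (by norm_num)) x d t).neg)
    (fun t => (hasDerivAt_fderiv_line φ hφ x d t).neg) (M := -(c * ‖d‖ ^ 2)) fun t => by
      rw [← inner_mulVec_hessian, neg_le_neg_iff]
      exact quadLE_smul_one_left.1 (h _) d
  simp only [one_smul, zero_smul, add_zero, Pi.neg_apply] at this
  rw [inner_gradient_eq]
  linarith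

theorem isSymm_hessian {φ : Vec n → ℝ} (hφ : ContDiff ℝ 2 φ) (x : Vec n) :
    (hessian φ x).IsSymm := by
  refine Matrix.IsSymm.ext fun a b => ?_
  simp only [hessian, Matrix.of_apply]
  exact (hφ.contDiffAt.isSymmSndFDerivAt (by simp)) _ _

end Hessian

/-! ### A two-time-scale system and its Lyapunov function -/

/-- The tracking error of the fast variables. -/
noncomputable def fastError {N : ℕ} {E X : Type*} [NormedAddCommGroup E] [NormedSpace ℝ E]
    (G : Fin N → X → E) (v y : Fin N → E) (x : Fin N → X) : ℝ :=
  nrm (fun i => v i - G i (x i)) + nrm fun i => y i - avg v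

theorem fastError_nonneg {N : ℕ} {E X : Type*} [NormedAddCommGroup E] [NormedSpace ℝ E]
    (G : Fin N → X → E) (v y : Fin N → E) (x : Fin N → X) :
    0 ≤ fastError G v y x := add_nonneg (nrm_nonneg _) (nrm_nonneg _)

section TwoTimeScale

variable {N : ℕ} {E X : Type*} [NormedAddCommGroup E] [NormedSpace ℝ E] [NormedAddCommGroup X]
  [NormedSpace ℝ X]

/-- The data of a consensus system with fast variables in `E` and slow variables in `X`: the fast
variables track the Lipschitz signals `G i` through a consensus matrix with contraction factor `ρ`,
and the slow ones follow the vector field `Ψ(x) - x`, for which `U` decreases on the diagonal. -/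
structure TwoTimeScale (P : Matrix (Fin N) (Fin N) ℝ) (G : Fin N → X → E) (Ψ : (Fin N → X) → X)
    (U : X → ℝ) (ρ L a γ δ₀ l b : ℝ) : Prop where
  ρ_nonneg : 0 ≤ ρ
  ρ_lt_one : ρ < 1
  L_pos : 0 < L
  a_pos : 0 < a
  γ_pos : 0 < γ
  δ₀_pos : 0 < δ₀
  l_pos : 0 < l
  b_pos : 0 < b
  row_sum : ∀ i, ∑ j, P i j = 1
  contracts : Contracts P ρ E
  lipschitz_G : ∀ i x x', ‖G i x - G i x'‖ ≤ L * ‖x - x'‖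
  lipschitz_Ψ : ∀ x x', ‖Ψ x - Ψ x'‖ ≤ a * nrm fun i => x i - x' i
  Ψ_zero : Ψ 0 = 0
  U_zero : U 0 = 0
  U_add_le : ∀ x d, U (x + d) ≤ U x + l * ‖d‖
  le_U : ∀ x, b * ‖x‖ ≤ U x
  U_step_le : ∀ x δ, 0 ≤ δ → δ ≤ δ₀ → U (x + δ • (Ψ (fun _ => x) - x)) ≤ (1 - γ * δ) * U x

/-- The Lyapunov function of the slow variables. -/
noncomputable def slowLyap (U : X → ℝ) (ν : ℝ) (x : Fin N → X) : ℝ :=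
  U (avg x) + ν * nrm fun i => x i - avg x

/-- The Lyapunov function of the whole system. -/
noncomputable def lyap (G : Fin N → X → E) (U : X → ℝ) (ν μ : ℝ) (v y : Fin N → E)
    (x : Fin N → X) : ℝ :=
  slowLyap U ν x + μ * fastError G v y x

/-- `(v', y', x')` is, up to errors proportional to `η`, the result of a step of length `θ` of the
fast variables and `ε θ` of the slow ones, the latter being perturbed by a multiple `C` of the
tracking error. -/
structure ApproxStep (P : Matrix (Fin N) (Fin N) ℝ) (G : Fin N → X → E) (Ψ : (Fin N → X) → X)
    (C ε θ η : ℝ) (v y : Fin N → E) (x : Fin N → X) (v' y' : Fin N → E) (x' : Fin N → X) :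
    Prop where
  v_le : nrm (fun i => v' i - (v i + θ • (G i (x i) - v i))) ≤ θ * η
  y_le : nrm (fun i => y' i - (y i + θ • (∑ j, P i j • (y j + G j (x j) - v j) - y i))) ≤ θ * η
  x_le : nrm (fun i => x' i - (x i + (ε * θ) • (Ψ x - x i))) ≤
    ε * θ * (C * fastError G v y x + η)

variable {P : Matrix (Fin N) (Fin N) ℝ} {G : Fin N → X → E} {Ψ : (Fin N → X) → X}
    {U : X → ℝ} {ρ L a γ δ₀ l b : ℝ}

theorem TwoTimeScale.U_nonneg (h : TwoTimeScale P G Ψ U ρ L a γ δ₀ l b) (x : X) : 0 ≤ U x :=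
  (mul_nonneg h.b_pos.le (norm_nonneg x)).trans (h.le_U x)

theorem TwoTimeScale.slowLyap_nonneg (h : TwoTimeScale P G Ψ U ρ L a γ δ₀ l b) {ν : ℝ}
    (hν : 0 ≤ ν) (x : Fin N → X) : 0 ≤ slowLyap U ν x :=
  add_nonneg (h.U_nonneg _) (mul_nonneg hν (nrm_nonneg _))

theorem TwoTimeScale.nrm_sub_G_le (h : TwoTimeScale P G Ψ U ρ L a γ δ₀ l b)
    (x x' : Fin N → X) :
    nrm (fun i => G i (x i) - G i (x' i)) ≤ L * nrm fun i => x i - x' i :=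
  nrm_le_mul h.L_pos.le fun i => h.lipschitz_G i _ _

/-- The slow Lyapunov function controls the norm. -/
theorem TwoTimeScale.nrm_le_slowLyap (h : TwoTimeScale P G Ψ U ρ L a γ δ₀ l b) {ν : ℝ}
    (hν : 0 < ν) (x : Fin N → X) : nrm x ≤ (ν⁻¹ + √N * b⁻¹) * slowLyap U ν x := by
  have h1 : nrm x ≤ nrm (fun i => x i - avg x) + nrm fun _ : Fin N => avg x := by
    simpa using nrm_add_le (fun i => x i - avg x) fun _ => avg x
  have h2 : nrm (fun _ : Fin N => avg x) ≤ √N * ‖avg x‖ :=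
    nrm_le_of_forall_le (norm_nonneg _) fun _ => le_rfl
  have h3 : ‖avg x‖ ≤ b⁻¹ * U (avg x) := by
    rw [inv_mul_eq_div, le_div_iff₀ h.b_pos, mul_comm]
    exact h.le_U _
  have hb := h.b_pos
  have hU := h.U_nonneg (avg x)
  have hQ := nrm_nonneg fun i => x i - avg x
  have h4 : 0 ≤ ν⁻¹ * U (avg x) := by positivity
  have h5 : 0 ≤ √N * b⁻¹ * (ν * nrm fun i => x i - avg x) := by positivity
  have h6 : ν⁻¹ * (ν * nrm fun i => x i - avg x) = nrm fun i => x i - avg x := by field_simp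
  have h7 : √N * ‖avg x‖ ≤ √N * (b⁻¹ * U (avg x)) := by gcongr
  rw [slowLyap]
  nlinarith

/-! ### Effect of one approximate step on each term of the Lyapunov function. -/

section Step

variable {C ε θ η : ℝ} {v y v' y' : Fin N → E} {x x' : Fin N → X}

/-- Since avg y = avg v, the vector u = y + G(x) - v has average avg G(x), towards which avg v
moves. Hence y and avg v relax with the same weight θ towards Pu and avg u, whose distance `P`
contracts. -/
theorem ApproxStep.nrm_avg_tracking_le [NeZero N] (hs : ApproxStep P G Ψ C ε θ η v y x v' y' x')
    (h : TwoTimeScale P G Ψ U ρ L a γ δ₀ l b) (hθ : 0 ≤ θ) (hθ1 : θ ≤ 1) (hyv : avg y = avg v) :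
    nrm (fun i => y' i - avg v') ≤
      (1 - θ) * nrm (fun i => y i - avg v)
        + θ * (ρ * (nrm (fun i => y i - avg v) + nrm fun i => v i - G i (x i)))
        + 2 * (θ * η) := by
  set ey : Fin N → E := fun i => y' i - (y i + θ • (∑ j, P i j • (y j + G j (x j) - v j) - y i))
    with hey
  set ev : Fin N → E := fun i => v' i - (v i + θ • (G i (x i) - v i)) with hev
  set u : Fin N → E := fun j => y j + G j (x j) - v j with hu
  set g : Fin N → E := fun j => G j (x j) with hg
  have hau : avg u = avg g := by
    rw [hu, avg_sub (fun j => y j + G j (x j)) v, avg_add y g, hyv]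
    abel
  have hav : avg v' = avg v + θ • (avg g - avg v) + avg ev := by
    have : v' = fun i => (v i + θ • (g i - v i)) + ev i := by
      ext i
      simp only [hev, hg]
      abel
    rw [this, avg_add, avg_add v, avg_smul θ fun i => g i - v i, avg_sub]
  have heq : (fun i => y' i - avg v') = fun i =>
      ((1 - θ) • (y i - avg v) + θ • (∑ j, P i j • u j - avg u)) + (ey i - avg ev) := by
    ext i
    rw [hav, hau]
    simp only [hey]
    module
  rw [heq]
  have h1 : nrm (fun i => ∑ j, P i j • u j - avg u) ≤
      ρ * (nrm (fun i => y i - avg v) + nrm fun i => v i - G i (x i)) := by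
    -- Pu - avg u does not change when a constant is subtracted from u, so only the distance of u
    -- from avg v counts.
    have h2 := h.contracts.nrm_le h.ρ_nonneg fun j => u j - avg v
    have h3 : (fun i => ∑ j, P i j • (u j - avg v) - avg fun j => u j - avg v) =
        fun i => ∑ j, P i j • u j - avg u := by
      ext i
      rw [avg_sub, avg_const]
      simp only [smul_sub, Finset.sum_sub_distrib, ← Finset.sum_smul, h.row_sum, one_smul]
      abel
    rw [h3] at h2
    refine h2.trans (mul_le_mul_of_nonneg_left ?_ h.ρ_nonneg)
    have h4 : (fun j => u j - avg v) = fun j => (y j - avg v) - (v j - G j (x j)) := by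
      ext j
      simp only [hu]
      abel
    rw [h4]
    exact nrm_sub_le _ _
  refine (nrm_add_le _ _).trans (add_le_add ((nrm_add_le _ _).trans (add_le_add ?_ ?_)) ?_)
  · rw [nrm_smul (by linarith)]
  · rw [nrm_smul hθ]
    gcongr
  · have h2 := nrm_sub_le ey fun _ => avg ev
    have h3 := nrm_const_avg_le ev
    linarith [hs.v_le, hs.y_le]

/-- The slow speed vanishes at the equilibrium because Ψ 0 = 0, so it is linear in x and in the
tracking error. It measures the drift of the tracked signals. -/
theorem ApproxStep.nrm_increment_le (hs : ApproxStep P G Ψ C ε θ η v y x v' y' x')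
    (h : TwoTimeScale P G Ψ U ρ L a γ δ₀ l b) (hε : 0 ≤ ε) (hθ : 0 ≤ θ) :
    nrm (fun i => x' i - x i) ≤
      ε * θ * ((√N * a + 1) * nrm x + C * fastError G v y x + η) := by
  have h1 : ‖Ψ x‖ ≤ a * nrm x := by
    simpa [h.Ψ_zero] using h.lipschitz_Ψ x 0
  have h2 : nrm (fun _ : Fin N => Ψ x) ≤ √N * (a * nrm x) :=
    nrm_le_of_forall_le (mul_nonneg h.a_pos.le (nrm_nonneg _)) fun _ => h1
  have h3 := nrm_sub_le (fun _ => Ψ x) x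
  have heq : (fun i => x' i - x i) = fun i =>
      (x' i - (x i + (ε * θ) • (Ψ x - x i))) + (ε * θ) • (Ψ x - x i) := by
    ext i
    abel
  rw [heq]
  refine (nrm_add_le _ _).trans ?_
  rw [nrm_smul (mul_nonneg hε hθ)]
  calc _ ≤ ε * θ * (C * fastError G v y x + η) + ε * θ * (√N * (a * nrm x) + nrm x) := by
        gcongr
        · exact hs.x_le
        · linarith
    _ = _ := by ring

/-- The register relaxes towards a moving signal; the drift costs L times the slow increment and so
carries the factor ε. -/
theorem ApproxStep.nrm_register_le (hs : ApproxStep P G Ψ C ε θ η v y x v' y' x')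
    (h : TwoTimeScale P G Ψ U ρ L a γ δ₀ l b) (hε : 0 ≤ ε) (hθ : 0 ≤ θ) (hθ1 : θ ≤ 1) :
    nrm (fun i => v' i - G i (x' i)) ≤
      (1 - θ) * nrm (fun i => v i - G i (x i))
        + L * (ε * θ * ((√N * a + 1) * nrm x + C * fastError G v y x + η)) + θ * η := by
  have heq : (fun i => v' i - G i (x' i)) = fun i =>
      ((1 - θ) • (v i - G i (x i)) - (G i (x' i) - G i (x i)))
        + (v' i - (v i + θ • (G i (x i) - v i))) := by
    ext i
    module
  rw [heq]
  refine (nrm_add_le _ _).trans (add_le_add ((nrm_sub_le _ _).trans (add_le_add ?_ ?_)) hs.v_le)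
  · rw [nrm_smul (by linarith)]
  · exact (h.nrm_sub_G_le x' x).trans
      (mul_le_mul_of_nonneg_left (hs.nrm_increment_le h hε hθ) h.L_pos.le)

/-- All agents are pulled to the same point Ψ x, which cancels in differences. -/
theorem ApproxStep.nrm_disagreement_le [NeZero N] (hs : ApproxStep P G Ψ C ε θ η v y x v' y' x')
    (hεθ : ε * θ ≤ 1) :
    nrm (fun i => x' i - avg x') ≤ (1 - ε * θ) * nrm (fun i => x i - avg x)
      + 2 * (ε * θ * (C * fastError G v y x + η)) := by
  set e : Fin N → X := fun i => x' i - (x i + (ε * θ) • (Ψ x - x i)) with he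
  have hx : x' = fun i => (x i + (ε * θ) • (Ψ x - x i)) + e i := by
    ext i
    simp only [he]
    abel
  have hav : avg x' = avg x + (ε * θ) • (Ψ x - avg x) + avg e := by
    conv_lhs => rw [hx]
    rw [avg_add, avg_add x, avg_smul (ε * θ) fun i => Ψ x - x i, avg_sub (fun _ => Ψ x),
      avg_const]
  have heq : (fun i => x' i - avg x') = fun i =>
      (1 - ε * θ) • (x i - avg x) + (e i - avg e) := by
    ext i
    rw [hav]
    simp only [he]
    module
  rw [heq]
  refine (nrm_add_le _ _).trans (add_le_add ?_ ?_)
  · rw [nrm_smul (by linarith)]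
  · have h2 := nrm_sub_le e fun _ => avg e
    have h3 := nrm_const_avg_le e
    linarith [hs.x_le]

/-- The average moves towards Ψ x instead of the value of Ψ on the diagonal at avg x; the
disagreement bounds the difference. -/
theorem ApproxStep.U_avg_le [NeZero N] (hs : ApproxStep P G Ψ C ε θ η v y x v' y' x')
    (h : TwoTimeScale P G Ψ U ρ L a γ δ₀ l b) (hε : 0 ≤ ε) (hθ : 0 ≤ θ) (hεθ : ε * θ ≤ δ₀) :
    U (avg x') ≤ (1 - γ * (ε * θ)) * U (avg x)
      + l * (ε * θ * (a * nrm (fun i => x i - avg x)) + ε * θ * (C * fastError G v y x + η)) := by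
  set e : Fin N → X := fun i => x' i - (x i + (ε * θ) • (Ψ x - x i)) with he
  have hx : x' = fun i => (x i + (ε * θ) • (Ψ x - x i)) + e i := by
    ext i
    simp only [he]
    abel
  have hav : avg x' = (avg x + (ε * θ) • (Ψ (fun _ => avg x) - avg x))
      + ((ε * θ) • (Ψ x - Ψ fun _ => avg x) + avg e) := by
    conv_lhs => rw [hx]
    rw [avg_add, avg_add x, avg_smul (ε * θ) fun i => Ψ x - x i, avg_sub (fun _ => Ψ x),
      avg_const]
    module
  rw [hav]
  refine (h.U_add_le _ _).trans (add_le_add (h.U_step_le _ _ (mul_nonneg hε hθ) hεθ) ?_)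
  refine mul_le_mul_of_nonneg_left ((norm_add_le _ _).trans (add_le_add ?_ ?_)) h.l_pos.le
  · rw [norm_smul, Real.norm_of_nonneg (mul_nonneg hε hθ)]
    exact mul_le_mul_of_nonneg_left (h.lipschitz_Ψ _ _) (mul_nonneg hε hθ)
  · exact (norm_avg_le e).trans hs.x_le

end Step

/-- For small `ε` the Lyapunov function decreases geometrically along approximate steps. -/
theorem TwoTimeScale.exists_lyap_le [NeZero N] (h : TwoTimeScale P G Ψ U ρ L a γ δ₀ l b) {C : ℝ}
    (hC : 0 ≤ C) :
    ∃ ν μ εbar r D : ℝ, 0 < ν ∧ 0 < μ ∧ 0 < εbar ∧ εbar ≤ 1 ∧ 0 < r ∧ r ≤ 1 / 2 ∧ 0 < D ∧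
      ∀ ε θ η : ℝ, 0 < ε → ε < εbar → 0 ≤ θ → θ ≤ 1 → 0 ≤ η →
      ∀ (v y v' y' : Fin N → E) (x x' : Fin N → X), avg y = avg v →
        ApproxStep P G Ψ C ε θ η v y x v' y' x' →
        lyap G U ν μ v' y' x' ≤ (1 - r * (ε * θ)) * lyap G U ν μ v y x + D * (θ * η) := by
  have hl := h.l_pos
  have ha := h.a_pos
  have hL := h.L_pos
  have hb := h.b_pos
  have hγ := h.γ_pos
  -- With this ν, the disagreement term l·a entering U uses exactly half of the decay of
  -- ν·(disagreement).
  obtain ⟨ν, hν⟩ : ∃ ν, ν = 2 * l * a := ⟨_, rfl⟩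
  have hν0 : 0 < ν := by rw [hν]; positivity
  -- The decay rate of the slow part: γ from U, and 1/2 left over from the disagreement.
  obtain ⟨g, hg⟩ : ∃ g, g = min γ (1 / 2) := ⟨_, rfl⟩
  have hg0 : 0 < g := by rw [hg]; exact lt_min hγ (by norm_num)
  have hgγ : g ≤ γ := hg ▸ min_le_left _ _
  have hg2 : g ≤ 1 / 2 := hg ▸ min_le_right _ _
  obtain ⟨K, hK⟩ : ∃ K, K = (√N * a + 1) * (ν⁻¹ + √N * b⁻¹) := ⟨_, rfl⟩
  have hK0 : 0 < K := by rw [hK]; positivity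
  -- The feedback of the slow variables into the tracking error, μLK, then costs half of the slow
  -- rate g; the other half is the final rate r.
  obtain ⟨μ, hμ⟩ : ∃ μ, μ = g / (2 * L * K) := ⟨_, rfl⟩
  have hμ0 : 0 < μ := by rw [hμ]; positivity
  have hμK : μ * L * K = g / 2 := by rw [hμ]; field_simp
  -- Everything of order ε that the fast decay μ(1 - ρ) must absorb: the perturbation of the slow
  -- part, that of the registers, and the decay rate g/2 claimed for the fast part.
  obtain ⟨R, hR⟩ : ∃ R, R = (l + 2 * ν) * C + μ * L * C + μ * (g / 2) := ⟨_, rfl⟩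
  have hR0 : 0 < R := by rw [hR]; positivity
  have hρ := h.ρ_lt_one
  refine ⟨ν, μ, min (min δ₀ 1) (μ * (1 - ρ) / R), g / 2, l + 2 * ν + μ * L + 3 * μ, hν0, hμ0,
    lt_min (lt_min h.δ₀_pos one_pos) (div_pos (mul_pos hμ0 (by linarith)) hR0),
    (min_le_left _ _).trans (min_le_right _ _), by positivity, by linarith, by positivity, ?_⟩
  intro ε θ η hε hεb hθ hθ1 hη v y v' y' x x' hyv hs
  have hε1 : ε < 1 := hεb.trans_le ((min_le_left _ _).trans (min_le_right _ _))
  have hεδ : ε < δ₀ := hεb.trans_le ((min_le_left _ _).trans (min_le_left _ _))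
  have hεR : ε * R ≤ μ * (1 - ρ) := by
    rw [← le_div_iff₀ hR0]
    exact hεb.le.trans (min_le_right _ _)
  have hεθ : ε * θ ≤ ε := mul_le_of_le_one_right hε.le hθ1
  have hB := hs.nrm_avg_tracking_le h hθ hθ1 hyv
  have hA := hs.nrm_register_le h hε.le hθ hθ1
  have hQ := hs.nrm_disagreement_le (by linarith)
  have hU := hs.U_avg_le h hε.le hθ (by linarith)
  have hX : (√N * a + 1) * nrm x ≤ K * slowLyap U ν x := by
    rw [hK, mul_assoc]
    exact mul_le_mul_of_nonneg_left (h.nrm_le_slowLyap hν0 x) (by positivity)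
  have hS0 := fastError_nonneg G v y x
  have hW0 := h.slowLyap_nonneg hν0.le x
  have hU0 := h.U_nonneg (avg x)
  have hQ0 := nrm_nonneg fun i => x i - avg x
  have hδ : 0 ≤ ε * θ := mul_nonneg hε.le hθ
  obtain ⟨δ, hδe⟩ : ∃ δ, δ = ε * θ := ⟨_, rfl⟩
  rw [← hδe] at hQ hU hA hδ ⊢
  have hδθ : δ ≤ θ := by rw [hδe]; exact mul_le_of_le_one_left hθ hε1.le
  obtain ⟨S, hS⟩ : ∃ S, S = fastError G v y x := ⟨_, rfl⟩
  obtain ⟨W, hW⟩ : ∃ W, W = slowLyap U ν x := ⟨_, rfl⟩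
  obtain ⟨S', hS'⟩ : ∃ S', S' = fastError G v' y' x' := ⟨_, rfl⟩
  obtain ⟨W', hW'⟩ : ∃ W', W' = slowLyap U ν x' := ⟨_, rfl⟩
  rw [← hS] at hQ hU hA hS0
  rw [← hW] at hX hW0
  have h1 : W' ≤ (1 - g * δ) * W + δ * ((l + 2 * ν) * (C * S + η)) := by
    rw [hW', hW, slowLyap, slowLyap]
    have e1 : g * δ * U (avg x) ≤ γ * δ * U (avg x) := by gcongr
    have e2 : g * δ * (ν * nrm fun i => x i - avg x) ≤
        1 / 2 * δ * (ν * nrm fun i => x i - avg x) := by gcongr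
    have e3 : l * a = ν / 2 := by rw [hν]; ring
    have e4 : l * (δ * (a * nrm fun i => x i - avg x)) =
        1 / 2 * δ * (ν * nrm fun i => x i - avg x) := by
      linear_combination (δ * nrm fun i => x i - avg x) * e3
    have e5 := mul_le_mul_of_nonneg_left hQ hν0.le
    linarith
  have h2 : S' ≤ (1 - θ * (1 - ρ)) * S + L * (δ * (K * W + C * S + η)) + 3 * (θ * η) := by
    have e1 : L * (δ * ((√N * a + 1) * nrm x + C * S + η)) ≤ L * (δ * (K * W + C * S + η)) := by
      gcongr
    have e2 : S = nrm (fun i => v i - G i (x i)) + nrm fun i => y i - avg v := hS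
    have e3 : S' = nrm (fun i => v' i - G i (x' i)) + nrm fun i => y' i - avg v' := hS'
    rw [e3]
    have e4 : (nrm fun i => y i - avg v) + (nrm fun i => v i - G i (x i)) = S := by
      rw [e2, add_comm]
    rw [e4] at hB
    have e5 : (1 - θ) * (nrm fun i => v i - G i (x i)) + (1 - θ) * (nrm fun i => y i - avg v)
        = (1 - θ) * S := by rw [e2]; ring
    linarith
  have h3 := mul_le_mul_of_nonneg_left h2 hμ0.le
  rw [lyap, lyap, ← hS, ← hW, ← hS', ← hW']
  have h4 : δ * ((l + 2 * ν) * (C * S)) + μ * (L * (δ * (C * S))) + μ * (g / 2 * δ * S)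
      ≤ μ * (θ * (1 - ρ) * S) := by
    calc _ = ε * R * (θ * S) := by rw [hR, hδe]; ring
      _ ≤ μ * (1 - ρ) * (θ * S) := mul_le_mul_of_nonneg_right hεR (mul_nonneg hθ hS0)
      _ = _ := by ring
  have h5 : μ * (L * (δ * (K * W))) = g / 2 * δ * W := by
    linear_combination δ * W * hμK
  have h6 : δ * ((l + 2 * ν) * η) ≤ θ * ((l + 2 * ν) * η) := by gcongr
  have h7 : μ * (L * (δ * η)) ≤ μ * (L * (θ * η)) := by gcongr
  linarith

/-- The distance of the state to the equilibrium, in the coordinates of the system. -/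
noncomputable def equilibriumDist (G : Fin N → X → E) (v y : Fin N → E) (x : Fin N → X) : ℝ :=
  nrm (fun i => v i - G i 0) + nrm (fun i => y i - avg fun j => G j 0) + nrm x

/-- Together with `TwoTimeScale.le_lyap`, this makes the Lyapunov function equivalent to the
distance to equilibrium, by triangle inequalities in which L pays for replacing G(x) by G(0). -/
theorem TwoTimeScale.lyap_le (h : TwoTimeScale P G Ψ U ρ L a γ δ₀ l b) [NeZero N] {ν μ : ℝ}
    (hν : 0 < ν) (hμ : 0 < μ) :
    ∃ K, 0 < K ∧ ∀ v y x, lyap G U ν μ v y x ≤ K * equilibriumDist G v y x := by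
  have hl := h.l_pos
  have hL := h.L_pos
  refine ⟨l + 2 * ν + μ * (2 + L), by positivity, fun v y x => ?_⟩
  have hU : U (avg x) ≤ l * nrm x := by
    have := h.U_add_le 0 (avg x)
    rw [h.U_zero, zero_add, zero_add] at this
    exact this.trans (mul_le_mul_of_nonneg_left (norm_avg_le x) hl.le)
  have hQ : nrm (fun i => x i - avg x) ≤ 2 * nrm x := by
    linarith [nrm_sub_le x fun _ => avg x, nrm_const_avg_le x]
  have hA : nrm (fun i => v i - G i (x i)) ≤ nrm (fun i => v i - G i 0) + L * nrm x := by
    have h1 := h.nrm_sub_G_le x 0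
    have h2 := nrm_sub_le (fun i => v i - G i 0) fun i => G i (x i) - G i 0
    simp only [Pi.zero_apply, sub_zero, sub_sub_sub_cancel_right] at h1 h2
    linarith
  have hB : nrm (fun i => y i - avg v) ≤
      nrm (fun i => y i - avg fun j => G j 0) + nrm (fun i => v i - G i 0) := by
    have h1 := nrm_sub_le (fun i => y i - avg fun j => G j 0) fun _ => avg fun i => v i - G i 0
    have h2 := nrm_const_avg_le fun i => v i - G i 0
    have h3 : (fun i => (y i - avg fun j => G j 0) - avg fun i => v i - G i 0)
        = fun i => y i - avg v := by
      ext i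
      rw [avg_sub]
      abel
    rw [h3] at h1
    linarith
  have h1 := nrm_nonneg fun i => v i - G i 0
  have h2 := nrm_nonneg fun i => y i - avg fun j => G j 0
  have h3 := nrm_nonneg x
  obtain ⟨d1, hd1⟩ : ∃ d, d = nrm fun i => v i - G i 0 := ⟨_, rfl⟩
  obtain ⟨d2, hd2⟩ : ∃ d, d = nrm fun i => y i - avg fun j => G j 0 := ⟨_, rfl⟩
  rw [lyap, slowLyap, fastError, equilibriumDist, ← hd1, ← hd2]
  rw [← hd1] at h1 hA hB
  rw [← hd2] at h2 hB
  have e1 := mul_le_mul_of_nonneg_left hQ hν.le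
  have e2 := mul_le_mul_of_nonneg_left (add_le_add hA hB) hμ.le
  have p1 : 0 ≤ l * d1 := by positivity
  have p2 : 0 ≤ l * d2 := by positivity
  have p3 : 0 ≤ ν * d1 := by positivity
  have p4 : 0 ≤ ν * d2 := by positivity
  have p5 : 0 ≤ μ * d2 := by positivity
  have p6 : 0 ≤ μ * nrm x := by positivity
  have p7 : 0 ≤ μ * L * d1 := by positivity
  have p8 : 0 ≤ μ * L * d2 := by positivity
  nlinarith

theorem TwoTimeScale.le_lyap (h : TwoTimeScale P G Ψ U ρ L a γ δ₀ l b) [NeZero N] {ν μ : ℝ}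
    (hν : 0 < ν) (hμ : 0 < μ) :
    ∃ K, 0 < K ∧ ∀ v y x, equilibriumDist G v y x ≤ K * lyap G U ν μ v y x := by
  have hL := h.L_pos
  have hb := h.b_pos
  obtain ⟨k, hk⟩ : ∃ k, k = ν⁻¹ + √N * b⁻¹ := ⟨_, rfl⟩
  have hk0 : 0 < k := by rw [hk]; positivity
  refine ⟨(2 * L + 1) * k + 2 * μ⁻¹, by positivity, fun v y x => ?_⟩
  have hX : nrm x ≤ k * slowLyap U ν x := hk ▸ h.nrm_le_slowLyap hν x
  have hA : nrm (fun i => v i - G i 0) ≤ nrm (fun i => v i - G i (x i)) + L * nrm x := by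
    have h1 := h.nrm_sub_G_le x 0
    have h2 := nrm_add_le (fun i => v i - G i (x i)) fun i => G i (x i) - G i 0
    simp only [Pi.zero_apply, sub_zero, sub_add_sub_cancel] at h1 h2
    linarith
  have hB : nrm (fun i => y i - avg fun j => G j 0) ≤
      nrm (fun i => y i - avg v) + nrm (fun i => v i - G i 0) := by
    have h1 := nrm_add_le (fun i => y i - avg v) fun _ => avg fun i => v i - G i 0
    have h2 := nrm_const_avg_le fun i => v i - G i 0
    have h3 : (fun i => (y i - avg v) + avg fun i => v i - G i 0)
        = fun i => y i - avg fun j => G j 0 := by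
      ext i
      rw [avg_sub]
      abel
    rw [h3] at h1
    linarith
  have hW0 := h.slowLyap_nonneg hν.le x
  have hS0 := fastError_nonneg G v y x
  have h1 := nrm_nonneg fun i => v i - G i (x i)
  have h2 := nrm_nonneg fun i => y i - avg v
  have hS : fastError G v y x
      = nrm (fun i => v i - G i (x i)) + nrm fun i => y i - avg v := rfl
  have hD : equilibriumDist G v y x ≤ (2 * L + 1) * (k * slowLyap U ν x)
      + 2 * fastError G v y x := by
    rw [equilibriumDist, hS]
    have e1 : (2 * L + 1) * nrm x ≤ (2 * L + 1) * (k * slowLyap U ν x) := by gcongr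
    linarith
  refine hD.trans ?_
  rw [lyap]
  have e1 : μ⁻¹ * (μ * fastError G v y x) = fastError G v y x := by field_simp
  have e2 : 0 ≤ μ⁻¹ * slowLyap U ν x := by positivity
  have e3 : 0 ≤ (2 * L + 1) * k * (μ * fastError G v y x) := by positivity
  nlinarith

end TwoTimeScale

/-! ### Curves given by integrals -/

section IsIntegralOn

open Filter Topology

variable {E : Type*} [NormedAddCommGroup E] [NormedSpace ℝ E] {u φ : ℝ → E} {T : ℝ}

theorem IsIntegralOn.continuousOn (h : IsIntegralOn u φ T) : ContinuousOn u (Set.Icc 0 T) := by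
  rcases lt_or_ge T 0 with hT | hT
  · rw [Set.Icc_eq_empty (not_le.2 hT)]
    exact continuousOn_empty u
  · have h1 := intervalIntegral.continuousOn_primitive_interval' h.1 Set.left_mem_uIcc
    rw [Set.uIcc_of_le hT] at h1
    exact (continuousOn_const.add h1).congr h.2

/-- The integrand `φ` may be discontinuous: only the reference field `q` and the error bound `d` are
continuous. This is what the thresholded slow equation requires; η is split between the variation of
`q` and that of `d`. -/
theorem IsIntegralOn.eventually_norm_sub_le [CompleteSpace E] (h : IsIntegralOn u φ T)
    {q : ℝ → E} {d : ℝ → ℝ} (hq : ContinuousOn q (Set.Icc 0 T)) (hd : ContinuousOn d (Set.Icc 0 T))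
    (hφ : ∀ τ ∈ Set.Icc 0 T, ‖φ τ - q τ‖ ≤ d τ) {t : ℝ} (ht : t ∈ Set.Ico 0 T) {η : ℝ}
    (hη : 0 < η) :
    ∀ᶠ z in 𝓝[>] t, ‖u z - (u t + (z - t) • q t)‖ ≤ (z - t) * (d t + η) := by
  have htI : t ∈ Set.Icc 0 T := ⟨ht.1, ht.2.le⟩
  have hsub : 𝓝[≥] t ≤ 𝓝[Set.Icc 0 T] t := by
    rw [← nhdsWithin_Icc_eq_nhdsGE ht.2]
    exact nhdsWithin_mono t (Set.Icc_subset_Icc_left ht.1)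
  have h1 : ∀ᶠ τ in 𝓝[Set.Icc 0 T] t, ‖q τ - q t‖ < η / 2 := by
    have := (hq t htI).sub (continuousWithinAt_const (b := q t)) |>.norm
    refine this.eventually_lt_const ?_
    simpa using half_pos hη
  have h2 : ∀ᶠ τ in 𝓝[Set.Icc 0 T] t, d τ < d t + η / 2 :=
    (hd t htI).eventually_lt_const (by linarith)
  have h3 : {τ | ‖φ τ - q t‖ ≤ d t + η} ∈ 𝓝[≥] t := by
    refine hsub ?_
    filter_upwards [h1, h2, self_mem_nhdsWithin] with τ a1 a2 a3
    have a4 := norm_add_le (φ τ - q τ) (q τ - q t)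
    rw [sub_add_sub_cancel] at a4
    linarith [hφ τ a3]
  obtain ⟨w, hw, hwS⟩ := mem_nhdsGE_iff_exists_Icc_subset.1 h3
  have hwt : t < w := hw
  filter_upwards [Ioo_mem_nhdsGT (lt_min hwt ht.2)] with z hz
  have hzw : z < w := hz.2.trans_le (min_le_left _ _)
  have hzT : z < T := hz.2.trans_le (min_le_right _ _)
  have hT : 0 ≤ T := ht.1.trans ht.2.le
  have hi1 : IntervalIntegrable φ MeasureTheory.volume 0 t := h.1.mono_set (by
    rw [Set.uIcc_of_le ht.1, Set.uIcc_of_le hT]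
    exact Set.Icc_subset_Icc_right ht.2.le)
  have hi2 : IntervalIntegrable φ MeasureTheory.volume t z := h.1.mono_set (by
    rw [Set.uIcc_of_le hz.1.le, Set.uIcc_of_le hT]
    exact Set.Icc_subset_Icc ht.1 hzT.le)
  have heq : u z - (u t + (z - t) • q t) = ∫ τ in t..z, (φ τ - q t) := by
    rw [h.2 z ⟨ht.1.trans hz.1.le, hzT.le⟩, h.2 t htI,
      ← intervalIntegral.integral_add_adjacent_intervals hi1 hi2,
      intervalIntegral.integral_sub hi2 intervalIntegrable_const,
      intervalIntegral.integral_const]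
    abel
  rw [heq]
  have := intervalIntegral.norm_integral_le_of_norm_le_const (a := t) (b := z)
    (f := fun τ => φ τ - q t) (C := d t + η) (fun τ hτ => by
      rw [Set.uIoc_of_le hz.1.le] at hτ
      exact hwS ⟨hτ.1.le, hτ.2.trans hzw.le⟩)
  rwa [abs_of_pos (sub_pos.2 hz.1), mul_comm] at this

theorem IsIntegralOn.hasDerivWithinAt [CompleteSpace E] (h : IsIntegralOn u φ T)
    (hφ : ContinuousOn φ (Set.Icc 0 T)) {t : ℝ} (ht : t ∈ Set.Ico 0 T) :
    HasDerivWithinAt u (φ t) (Set.Ici t) t := by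
  rw [← hasDerivWithinAt_Ioi_iff_Ici, hasDerivWithinAt_iff_isLittleO, Asymptotics.isLittleO_iff]
  intro η hη
  filter_upwards [h.eventually_norm_sub_le hφ (continuousOn_const (c := (0 : ℝ)))
    (fun τ _ => by simp) ht hη, self_mem_nhdsWithin] with z hz hzt
  rw [Real.norm_of_nonneg (sub_nonneg.2 (le_of_lt hzt)), sub_sub]
  rwa [zero_add, mul_comm] at hz

theorem eventually_norm_sub_le_of_hasDerivWithinAt {u : ℝ → E} {u' : E} {t : ℝ}
    (h : HasDerivWithinAt u u' (Set.Ici t) t) {η : ℝ} (hη : 0 < η) :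
    ∀ᶠ z in 𝓝[>] t, ‖u z - (u t + (z - t) • u')‖ ≤ (z - t) * η := by
  rw [← hasDerivWithinAt_Ioi_iff_Ici, hasDerivWithinAt_iff_isLittleO,
    Asymptotics.isLittleO_iff] at h
  filter_upwards [h hη, self_mem_nhdsWithin] with z hz hzt
  rwa [Real.norm_of_nonneg (sub_nonneg.2 (le_of_lt hzt)), sub_sub, mul_comm] at hz

end IsIntegralOn

/-! ### Exponential decay of the Lyapunov function -/

/-- The slow perturbation depends on the distance to the current average signal, while `fastError`
compares with the registers; avg (v - G(x)) is the difference. -/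
theorem nrm_sub_avg_G_le {N : ℕ} {E X : Type*} [NormedAddCommGroup E] [NormedSpace ℝ E]
    (G : Fin N → X → E) (v y : Fin N → E) (x : Fin N → X) :
    nrm (fun i => y i - avg fun j => G j (x j)) ≤ fastError G v y x := by
  have h1 := nrm_add_le (fun i => y i - avg v) fun _ => avg fun i => v i - G i (x i)
  have h2 := nrm_const_avg_le fun i => v i - G i (x i)
  have h3 : (fun i => (y i - avg v) + avg fun i => v i - G i (x i))
      = fun i => y i - avg fun j => G j (x j) := by
    ext i
    rw [avg_sub]
    abel
  rw [h3] at h1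
  rw [fastError]
  linarith

section Decay

open Filter Topology

variable {N : ℕ} {E X : Type*} [NormedAddCommGroup E] [NormedSpace ℝ E] [NormedAddCommGroup X]
  [NormedSpace ℝ X] {P : Matrix (Fin N) (Fin N) ℝ} {G : Fin N → X → E} {Ψ : (Fin N → X) → X}
  {U : X → ℝ} {ρ L a γ δ₀ l b : ℝ}

theorem continuous_avg {F : Type*} [NormedAddCommGroup F] [NormedSpace ℝ F] :
    Continuous fun u : Fin N → F => avg u := by
  unfold avg
  fun_prop

theorem TwoTimeScale.continuous_G (h : TwoTimeScale P G Ψ U ρ L a γ δ₀ l b) (i : Fin N) :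
    Continuous (G i) :=
  (LipschitzWith.of_dist_le_mul (K := ⟨L, h.L_pos.le⟩) fun x y => by
    simpa only [dist_eq_norm] using! h.lipschitz_G i x y).continuous

theorem TwoTimeScale.continuous_U (h : TwoTimeScale P G Ψ U ρ L a γ δ₀ l b) : Continuous U := by
  refine (LipschitzWith.of_le_add_mul ⟨l, h.l_pos.le⟩ fun x y => ?_).continuous
  have := h.U_add_le y (x - y)
  rw [add_sub_cancel] at this
  simpa only [dist_eq_norm] using! this

theorem TwoTimeScale.continuous_Ψ (h : TwoTimeScale P G Ψ U ρ L a γ δ₀ l b) : Continuous Ψ := by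
  rw [continuous_iff_continuousAt]
  intro x
  rw [ContinuousAt, tendsto_iff_norm_sub_tendsto_zero]
  have h1 : Tendsto (fun x' => a * nrm fun i => x' i - x i) (𝓝 x) (𝓝 0) := by
    have : Continuous fun x' : Fin N → X => a * nrm fun i => x' i - x i :=
      continuous_const.mul (continuous_nrm.comp (by fun_prop))
    have h2 := this.tendsto x
    simpa [nrm_eq_sqrt] using h2
  exact squeeze_zero (fun _ => norm_nonneg _) (fun x' => h.lipschitz_Ψ x' x) h1

theorem TwoTimeScale.continuous_lyap (h : TwoTimeScale P G Ψ U ρ L a γ δ₀ l b) (ν μ : ℝ) :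
    Continuous fun p : (Fin N → E) × (Fin N → E) × (Fin N → X) =>
      lyap G U ν μ p.1 p.2.1 p.2.2 := by
  have hU := h.continuous_U
  have hG := h.continuous_G
  have ha := continuous_avg (N := N) (F := X)
  have ha' := continuous_avg (N := N) (F := E)
  unfold lyap slowLyap fastError
  have h1 : Continuous fun p : (Fin N → E) × (Fin N → E) × (Fin N → X) =>
      nrm fun i => p.2.2 i - avg p.2.2 := continuous_nrm.comp (by fun_prop)
  have h2 : Continuous fun p : (Fin N → E) × (Fin N → E) × (Fin N → X) =>
      nrm fun i => p.1 i - G i (p.2.2 i) := continuous_nrm.comp (by fun_prop)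
  have h3 : Continuous fun p : (Fin N → E) × (Fin N → E) × (Fin N → X) =>
      nrm fun i => p.2.1 i - avg p.1 := continuous_nrm.comp (by fun_prop)
  fun_prop

/-- Exponential decay along the flow, from the decrease along approximate steps. -/
theorem TwoTimeScale.lyap_le_exp [CompleteSpace X] (h : TwoTimeScale P G Ψ U ρ L a γ δ₀ l b)
    {C ν μ r D ε T : ℝ} (hC : 0 ≤ C) (hD : 0 < D) (hε : 0 < ε) (hε1 : ε ≤ 1)
    (hstep : ∀ θ η : ℝ, 0 ≤ θ → θ ≤ 1 → 0 ≤ η →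
      ∀ (v y v' y' : Fin N → E) (x x' : Fin N → X), avg y = avg v →
        ApproxStep P G Ψ C ε θ η v y x v' y' x' →
        lyap G U ν μ v' y' x' ≤ (1 - r * (ε * θ)) * lyap G U ν μ v y x + D * (θ * η))
    {v y : ℝ → Fin N → E} {x φ : ℝ → Fin N → X}
    (hvc : ∀ i, ContinuousOn (fun t => v t i) (Set.Icc 0 T))
    (hyc : ∀ i, ContinuousOn (fun t => y t i) (Set.Icc 0 T))
    (hv : ∀ i, ∀ t ∈ Set.Ico 0 T,
      HasDerivWithinAt (fun t => v t i) (ε⁻¹ • (G i (x t i) - v t i)) (Set.Ici t) t)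
    (hy : ∀ i, ∀ t ∈ Set.Ico 0 T, HasDerivWithinAt (fun t => y t i)
      (ε⁻¹ • (∑ j, P i j • (y t j + G j (x t j) - v t j) - y t i)) (Set.Ici t) t)
    (hx : ∀ i, IsIntegralOn (fun t => x t i) (fun t => φ t i) T)
    (hφ : ∀ i, ∀ t ∈ Set.Icc 0 T, ‖φ t i - (Ψ (x t) - x t i)‖ ≤
      C * ‖y t i - avg fun j => G j (x t j)‖)
    (hyv : ∀ t ∈ Set.Icc 0 T, avg (y t) = avg (v t)) :
    ∀ t ∈ Set.Icc 0 T, lyap G U ν μ (v t) (y t) (x t) ≤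
      lyap G U ν μ (v 0) (y 0) (x 0) * Real.exp (-r * t) := by
  have hxc : ∀ i, ContinuousOn (fun t => x t i) (Set.Icc 0 T) := fun i => (hx i).continuousOn
  have hxc' : ContinuousOn x (Set.Icc 0 T) := continuousOn_pi.2 hxc
  have hΦc : ContinuousOn (fun t => lyap G U ν μ (v t) (y t) (x t)) (Set.Icc 0 T) :=
    (h.continuous_lyap ν μ).comp_continuousOn
      ((continuousOn_pi.2 hvc).prodMk ((continuousOn_pi.2 hyc).prodMk hxc'))
  have hqc : ∀ i, ContinuousOn (fun t => Ψ (x t) - x t i) (Set.Icc 0 T) := fun i =>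
    (h.continuous_Ψ.comp_continuousOn hxc').sub (hxc i)
  have hdc : ∀ i, ContinuousOn (fun t => C * ‖y t i - avg fun j => G j (x t j)‖)
      (Set.Icc 0 T) := fun i =>
    continuousOn_const.mul ((hyc i).sub (continuous_avg.comp_continuousOn
      (continuousOn_pi.2 fun j => (h.continuous_G j).comp_continuousOn (hxc j)))).norm
  -- The right Dini derivative of the Lyapunov function is at most -r times its value.
  have key : ∀ t ∈ Set.Ico 0 T, ∀ R, -r * lyap G U ν μ (v t) (y t) (x t) < R →
      ∀ᶠ z in 𝓝[>] t, (z - t)⁻¹ * (lyap G U ν μ (v z) (y z) (x z)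
        - lyap G U ν μ (v t) (y t) (x t)) < R := by
    intro t ht R hR
    obtain ⟨Φ, hΦ⟩ : ∃ Φ, Φ = lyap G U ν μ (v t) (y t) (x t) := ⟨_, rfl⟩
    rw [← hΦ] at hR ⊢
    -- Chosen so that the error D·θ·(√N + 1)·η of the step is (z - t) times half of the gap between
    -- R and -rΦ; √N + 1 converts bounds for each agent into bounds for `nrm`.
    obtain ⟨η, hη⟩ : ∃ η, η = ε * (R + r * Φ) / (2 * D * (√N + 1)) := ⟨_, rfl⟩
    have hη0 : 0 < η := by
      have : 0 < R + r * Φ := by linarith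
      rw [hη]
      positivity
    have e1 := eventually_all.2 fun i => eventually_norm_sub_le_of_hasDerivWithinAt (hv i t ht) hη0
    have e2 := eventually_all.2 fun i => eventually_norm_sub_le_of_hasDerivWithinAt (hy i t ht) hη0
    have e3 := eventually_all.2 fun i =>
      (hx i).eventually_norm_sub_le (hqc i) (hdc i) (hφ i) ht hη0
    filter_upwards [e1, e2, e3, Ioo_mem_nhdsGT (show t < t + ε by linarith)] with z z1 z2 z3 hz
    have hzt : 0 < z - t := sub_pos.2 hz.1
    -- Time z - t is a fast step of length θ and a slow step ε θ = z - t, so the resulting rate r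
    -- does not involve ε.
    obtain ⟨θ, hθ⟩ : ∃ θ, θ = (z - t) / ε := ⟨_, rfl⟩
    have hθ0 : 0 < θ := by rw [hθ]; positivity
    have hθ1 : θ ≤ 1 := by
      rw [hθ, div_le_one hε]
      linarith [hz.2]
    have hεθ : ε * θ = z - t := by rw [hθ]; field_simp
    have hεθ' : (z - t) * ε⁻¹ = θ := by rw [hθ, div_eq_mul_inv]
    have hN : 0 ≤ √(N : ℝ) := Real.sqrt_nonneg _
    have hzθ : z - t ≤ θ := by
      rw [← hεθ]
      exact mul_le_of_le_one_left hθ0.le hε1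
    have hs : ApproxStep P G Ψ C ε θ ((√N + 1) * η) (v t) (y t) (x t) (v z) (y z) (x z) := by
      refine ⟨?_, ?_, ?_⟩
      · refine (nrm_le_of_forall_le (r := (z - t) * η) (by positivity) fun i => ?_).trans ?_
        · have := z1 i
          rwa [smul_smul, hεθ'] at this
        · calc √N * ((z - t) * η) ≤ (√N + 1) * (θ * η) := by gcongr; linarith
            _ = _ := by ring
      · refine (nrm_le_of_forall_le (r := (z - t) * η) (by positivity) fun i => ?_).trans ?_
        · have := z2 i
          rwa [smul_smul, hεθ'] at this
        · calc √N * ((z - t) * η) ≤ (√N + 1) * (θ * η) := by gcongr; linarith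
            _ = _ := by ring
      · rw [hεθ]
        have a1 := nrm_mono (u := fun i => x z i - (x t i + (z - t) • (Ψ (x t) - x t i)))
          (v := fun i => (z - t) • (C • ‖y t i - avg fun j => G j (x t j)‖ + η)) fun i => by
            refine (z3 i).trans ?_
            rw [smul_eq_mul, smul_eq_mul, Real.norm_of_nonneg (by positivity)]
        rw [nrm_smul hzt.le] at a1
        refine a1.trans (mul_le_mul_of_nonneg_left ?_ hzt.le)
        refine (nrm_add_le _ _).trans (add_le_add ?_ ?_)
        · rw [nrm_smul hC]
          refine mul_le_mul_of_nonneg_left (le_trans (nrm_mono fun i => ?_)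
            (nrm_sub_avg_G_le G (v t) (y t) (x t))) hC
          rw [norm_norm]
        · refine (nrm_le_of_forall_le hη0.le fun i => by
            rw [Real.norm_of_nonneg hη0.le]).trans ?_
          gcongr
          linarith
    have hfin := hstep θ ((√N + 1) * η) hθ0.le hθ1 (by positivity) _ _ _ _ _ _
      (hyv t ⟨ht.1, ht.2.le⟩) hs
    rw [← hΦ, hεθ] at hfin
    have h5 : D * (θ * ((√N + 1) * η)) = (z - t) * ((R + r * Φ) / 2) := by
      rw [hη, ← hεθ]
      field_simp
    rw [inv_mul_lt_iff₀ hzt]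
    have : (z - t) * ((R + r * Φ) / 2) < (z - t) * (R + r * Φ) := by
      gcongr
      linarith
    nlinarith
  intro t ht
  have := le_gronwallBound_of_liminf_deriv_right_le (K := -r) (ε := 0)
    (f' := fun t => -r * lyap G U ν μ (v t) (y t) (x t)) hΦc
    (fun t ht R hR => (key t ht R hR).frequently) le_rfl (fun t _ => by simp) t ht
  rwa [gronwallBound_ε0, sub_zero] at this

end Decay

/-! ### Matrices acting on Euclidean space -/

section MulVec

variable {n : ℕ}

theorem mulVec_add (A : Mat n) (u v : Vec n) : mulVec A (u + v) = mulVec A u + mulVec A v :=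
  map_add _ _ _

theorem mulVec_sub (A : Mat n) (u v : Vec n) : mulVec A (u - v) = mulVec A u - mulVec A v :=
  map_sub _ _ _

theorem mulVec_zero (A : Mat n) : mulVec A 0 = 0 := map_zero _

theorem mulVec_smul (A : Mat n) (t : ℝ) (u : Vec n) : mulVec A (t • u) = t • mulVec A u :=
  map_smul _ _ _

theorem sub_mulVec (A B : Mat n) (u : Vec n) : mulVec (A - B) u = mulVec A u - mulVec B u := by
  simp only [mulVec, map_sub, LinearMap.sub_apply]

theorem add_mulVec (A B : Mat n) (u : Vec n) : mulVec (A + B) u = mulVec A u + mulVec B u := by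
  simp only [mulVec, map_add, LinearMap.add_apply]

theorem smul_mulVec (t : ℝ) (A : Mat n) (u : Vec n) : mulVec (t • A) u = t • mulVec A u := by
  simp only [mulVec, map_smul, LinearMap.smul_apply]

theorem one_mulVec (u : Vec n) : mulVec (1 : Mat n) u = u := by
  simpa using mulVec_smul_one 1 u

theorem mulVec_mulVec (A B : Mat n) (u : Vec n) : mulVec A (mulVec B u) = mulVec (A * B) u := by
  simp [mulVec, Matrix.toLpLin_apply, Matrix.mulVec_mulVec]

theorem norm_mulVec_le (A : Mat n) (u : Vec n) : ‖mulVec A u‖ ≤ ‖A‖ * ‖u‖ := by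
  refine abs_le_of_sq_le_sq' ?_ (by positivity) |>.2
  rw [mul_pow, norm_sq_mat, EuclideanSpace.real_norm_sq_eq, EuclideanSpace.real_norm_sq_eq,
    Finset.sum_mul]
  refine Finset.sum_le_sum fun i _ => ?_
  rw [mulVec_apply]
  exact Finset.sum_mul_sq_le_sq_mul_sq _ _ _

/-- Evaluation `A ↦ A u` at a vector. -/
noncomputable def mulVecRight (u : Vec n) : Mat n →L[ℝ] Vec n :=
  LinearMap.mkContinuous
    { toFun := fun A => mulVec A u
      map_add' := fun A B => add_mulVec A B u
      map_smul' := fun t A => smul_mulVec t A u } ‖u‖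
    fun A => by
      rw [mul_comm]
      exact norm_mulVec_le A u

theorem inner_mulVec_comm {A : Mat n} (hA : A.IsSymm) (u v : Vec n) :
    inner ℝ u (mulVec A v) = inner ℝ (mulVec A u) v := by
  simp only [PiLp.inner_apply, mulVec_apply, RCLike.inner_apply, conj_trivial, Finset.mul_sum,
    Finset.sum_mul]
  rw [Finset.sum_comm]
  refine Finset.sum_congr rfl fun i _ => Finset.sum_congr rfl fun j _ => ?_
  rw [hA.apply i j]
  ring

theorem le_norm_mulVec {A : Mat n} {c : ℝ} (h : QuadLE (c • (1 : Mat n)) A) (u : Vec n) :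
    c * ‖u‖ ≤ ‖mulVec A u‖ := by
  have h1 := (quadLE_smul_one_left.1 h u).trans (real_inner_le_norm _ _)
  rcases (norm_nonneg u).eq_or_lt with h0 | h0
  · rw [← h0, mul_zero]
    positivity
  · refine le_of_mul_le_mul_left ?_ h0
    linarith

theorem isUnit_det_of_quadLE {A : Mat n} {c : ℝ} (hc : 0 < c) (h : QuadLE (c • (1 : Mat n)) A) :
    IsUnit A.det := by
  rw [← Matrix.isUnit_iff_isUnit_det, ← Matrix.mulVec_injective_iff_isUnit]
  intro p q hpq
  have h1 := le_norm_mulVec h (WithLp.toLp 2 p - WithLp.toLp 2 q)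
  have h2 : mulVec A (WithLp.toLp 2 p - WithLp.toLp 2 q) = 0 := by
    rw [mulVec_sub]
    simp only [mulVec, Matrix.toLpLin_apply]
    rw [hpq, sub_self]
  rw [h2, norm_zero] at h1
  have h3 : ‖WithLp.toLp 2 p - WithLp.toLp 2 q‖ = 0 :=
    le_antisymm (by_contra fun h4 => by
      have := mul_pos hc (not_le.1 h4)
      linarith) (norm_nonneg _)
  exact WithLp.toLp_injective 2 (sub_eq_zero.1 (norm_eq_zero.1 h3))

theorem mulVec_inv_mulVec {A : Mat n} {c : ℝ} (hc : 0 < c) (h : QuadLE (c • (1 : Mat n)) A)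
    (u : Vec n) : mulVec A (mulVec A⁻¹ u) = u := by
  rw [mulVec_mulVec, Matrix.mul_nonsing_inv _ (isUnit_det_of_quadLE hc h), one_mulVec]

theorem inv_mulVec_mulVec {A : Mat n} {c : ℝ} (hc : 0 < c) (h : QuadLE (c • (1 : Mat n)) A)
    (u : Vec n) : mulVec A⁻¹ (mulVec A u) = u := by
  rw [mulVec_mulVec, Matrix.nonsing_inv_mul _ (isUnit_det_of_quadLE hc h), one_mulVec]

/-- Cocoercivity of a positive symmetric matrix. -/
theorem norm_mulVec_sq_le {A : Mat n} {c m : ℝ} (hc : 0 ≤ c) (hm : 0 < m) (hA : A.IsSymm)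
    (hl : QuadLE (c • (1 : Mat n)) A) (hu : QuadLE A (m • (1 : Mat n))) (u : Vec n) :
    ‖mulVec A u‖ ^ 2 ≤ m * inner ℝ u (mulVec A u) := by
  set w := mulVec A u with hw
  -- Expanding this form and using ⟨w, Aw⟩ ≤ m‖w‖² leaves ‖w‖²/m ≤ ⟨u, w⟩.
  have h1 : 0 ≤ inner ℝ (u - m⁻¹ • w) (mulVec A (u - m⁻¹ • w)) :=
    (by positivity : (0 : ℝ) ≤ c * ‖u - m⁻¹ • w‖ ^ 2).trans (quadLE_smul_one_left.1 hl _)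
  have h2 := quadLE_smul_one_right.1 hu w
  have h0 : inner ℝ u (mulVec A w) = ‖w‖ ^ 2 := by
    rw [inner_mulVec_comm hA, ← hw, real_inner_self_eq_norm_sq]
  rw [mulVec_sub, mulVec_smul, inner_sub_left, inner_sub_right, inner_sub_right, ← hw] at h1
  simp only [inner_smul_left, inner_smul_right, real_inner_self_eq_norm_sq, conj_trivial, h0] at h1
  have h3 : m⁻¹ * (m⁻¹ * inner ℝ w (mulVec A w)) ≤ m⁻¹ * (m⁻¹ * (m * ‖w‖ ^ 2)) := by gcongr
  have h4 : m⁻¹ * (m⁻¹ * (m * ‖w‖ ^ 2)) = m⁻¹ * ‖w‖ ^ 2 := by field_simp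
  have h5 : m⁻¹ * ‖w‖ ^ 2 ≤ inner ℝ u w := by linarith
  calc ‖w‖ ^ 2 = m * (m⁻¹ * ‖w‖ ^ 2) := by field_simp
    _ ≤ _ := by gcongr

theorem norm_mulVec_le_of_quadLE {A : Mat n} {c m : ℝ} (hc : 0 ≤ c) (hm : 0 < m) (hA : A.IsSymm)
    (hl : QuadLE (c • (1 : Mat n)) A) (hu : QuadLE A (m • (1 : Mat n))) (u : Vec n) :
    ‖mulVec A u‖ ≤ m * ‖u‖ := by
  refine abs_le_of_sq_le_sq' ?_ (by positivity) |>.2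
  calc ‖mulVec A u‖ ^ 2 ≤ m * inner ℝ u (mulVec A u) := norm_mulVec_sq_le hc hm hA hl hu u
    _ ≤ m * (m * ‖u‖ ^ 2) := by gcongr; exact quadLE_smul_one_right.1 hu u
    _ = _ := by ring

/-! ### The thresholding -/

theorem quadLE_thresh (c : ℝ) (z : Mat n) : QuadLE ((c / 2) • (1 : Mat n)) (thresh c z) := by
  unfold thresh
  split_ifs with h
  · exact h
  · exact fun u => le_rfl

/-- When the thresholding is active at `z`, every `A ≥ c I` is far from `z`. -/
theorem le_norm_sub_of_not_quadLE {A z : Mat n} {c : ℝ} (hl : QuadLE (c • (1 : Mat n)) A)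
    (hz : ¬ QuadLE ((c / 2) • (1 : Mat n)) z) : c / 2 ≤ ‖z - A‖ := by
  rw [quadLE_smul_one_left] at hz
  push Not at hz
  obtain ⟨u, hu⟩ := hz
  have h1 := quadLE_smul_one_left.1 hl u
  have h2 : inner ℝ u (mulVec (A - z) u) ≤ ‖z - A‖ * ‖u‖ ^ 2 := by
    refine (real_inner_le_norm _ _).trans ?_
    have := norm_mulVec_le (A - z) u
    rw [norm_sub_rev] at this
    calc ‖u‖ * ‖mulVec (A - z) u‖ ≤ ‖u‖ * (‖z - A‖ * ‖u‖) := by gcongr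
      _ = _ := by ring
  rw [sub_mulVec, inner_sub_right] at h2
  have h3 : u ≠ 0 := by
    rintro rfl
    simp [mulVec_zero] at hu
  have h4 : 0 < ‖u‖ ^ 2 := by positivity
  refine le_of_mul_le_mul_right ?_ h4
  linarith

/-- If the threshold acts, the difference is at most c/2 + m in size while ‖z - A‖ ≥ c/2; the
constant satisfies (2 + 2m/c)·c/2 = c + m. -/
theorem norm_sub_thresh_mulVec_le {A z : Mat n} {c m : ℝ} (hc : 0 < c) (hm : 0 < m)
    (hA : A.IsSymm) (hl : QuadLE (c • (1 : Mat n)) A) (hu : QuadLE A (m • (1 : Mat n)))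
    (p : Vec n) :
    ‖mulVec (A - thresh c z) p‖ ≤ (2 + 2 * m / c) * ‖z - A‖ * ‖p‖ := by
  by_cases h : QuadLE ((c / 2) • (1 : Mat n)) z
  · rw [thresh, if_pos h]
    refine (norm_mulVec_le _ _).trans ?_
    rw [norm_sub_rev]
    gcongr
    have : 0 ≤ 2 * m / c := by positivity
    nlinarith [norm_nonneg (z - A)]
  · rw [thresh, if_neg h, sub_mulVec, mulVec_smul_one]
    have h1 := le_norm_sub_of_not_quadLE hl h
    refine (norm_sub_le _ _).trans ?_
    rw [norm_smul, Real.norm_of_nonneg (by positivity)]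
    have h2 := norm_mulVec_le_of_quadLE hc.le hm hA hl hu p
    have h3 : (2 + 2 * m / c) * (c / 2) * ‖p‖ ≤ (2 + 2 * m / c) * ‖z - A‖ * ‖p‖ := by gcongr
    have h4 : (2 + 2 * m / c) * (c / 2) * ‖p‖ = c * ‖p‖ + m * ‖p‖ := by field_simp
    have h5 : 0 ≤ c * ‖p‖ := by positivity
    linarith

/-- The thresholded Newton direction is a Lipschitz perturbation of the exact one. -/
theorem norm_thresh_inv_mulVec_sub_le {A z : Mat n} {c m M : ℝ} (hc : 0 < c) (hm : 0 < m)
    (hA : A.IsSymm) (hl : QuadLE (c • (1 : Mat n)) A) (hu : QuadLE A (m • (1 : Mat n)))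
    (xs y g : Vec n) (hg : ‖g‖ ≤ M) :
    ‖mulVec (thresh c z)⁻¹ y - xs - mulVec A⁻¹ g‖ ≤
      2 / c * ‖y - mulVec z xs - g‖
        + 2 / c * (‖xs‖ + (2 + 2 * m / c) * (‖xs‖ + M / c)) * ‖z - A‖ := by
  have hM : 0 ≤ M := (norm_nonneg g).trans hg
  set Z := thresh c z with hZ
  set ψ := mulVec A⁻¹ g with hψ
  have hAψ : mulVec A ψ = g := mulVec_inv_mulVec hc hl g
  have hψM : ‖ψ‖ ≤ M / c := by
    rw [le_div_iff₀ hc, mul_comm]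
    refine (le_norm_mulVec hl ψ).trans ?_
    rwa [hAψ]
  have hZq : QuadLE ((c / 2) • (1 : Mat n)) Z := quadLE_thresh c z
  have h1 := le_norm_mulVec hZq (mulVec Z⁻¹ y - xs - ψ)
  -- Multiplying by `Z` avoids any estimate on the difference of inverses; dividing back costs 2/c
  -- because Z ≥ (c/2) I.
  have heq : mulVec Z (mulVec Z⁻¹ y - xs - ψ) =
      (y - mulVec z xs - g) + (mulVec (z - A) xs + mulVec (A - Z) (xs + ψ)) := by
    rw [mulVec_sub, mulVec_sub, mulVec_inv_mulVec (half_pos hc) hZq]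
    simp only [sub_mulVec, mulVec_add, hAψ]
    abel
  have h2 : ‖mulVec Z (mulVec Z⁻¹ y - xs - ψ)‖ ≤ ‖y - mulVec z xs - g‖ +
      (‖z - A‖ * ‖xs‖ + (2 + 2 * m / c) * ‖z - A‖ * (‖xs‖ + M / c)) := by
    rw [heq]
    refine (norm_add_le _ _).trans (add_le_add le_rfl ((norm_add_le _ _).trans
      (add_le_add (norm_mulVec_le _ _) ((norm_sub_thresh_mulVec_le hc hm hA hl hu _).trans ?_))))
    gcongr
    exact (norm_add_le _ _).trans (add_le_add le_rfl hψM)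
  have h3 := h1.trans h2
  calc ‖mulVec Z⁻¹ y - xs - ψ‖ = 2 / c * (c / 2 * ‖mulVec Z⁻¹ y - xs - ψ‖) := by field_simp
    _ ≤ 2 / c * (‖y - mulVec z xs - g‖ +
        (‖z - A‖ * ‖xs‖ + (2 + 2 * m / c) * ‖z - A‖ * (‖xs‖ + M / c))) := by gcongr
    _ = _ := by ring

end MulVec

/-! ### Translated costs -/

section Costs

variable {N n : ℕ}

theorem hessian_translate (φ : Vec n → ℝ) (xs x : Vec n) :
    hessian (fun x => φ (x + xs)) x = hessian φ (x + xs) := by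
  have h1 : fderiv ℝ (fun x => φ (x + xs)) = fun x => fderiv ℝ φ (x + xs) :=
    funext fun x => fderiv_comp_add_right xs
  simp only [hessian, h1, fderiv_comp_add_right]

theorem gradient_translate (φ : Vec n → ℝ) (xs x : Vec n) :
    gradient (fun x => φ (x + xs)) x = gradient φ (x + xs) := by
  rw [gradient, gradient, fderiv_comp_add_right]

theorem hLoc_translate (κ : Curvature) (f : Fin N → Vec n → ℝ) (xs : Vec n) (i : Fin N)
    (x : Vec n) : hLoc κ (translate f xs i) x = hLoc κ (f i) (x + xs) := by
  have h : hessian (translate f xs i) x = hessian (f i) (x + xs) := hessian_translate (f i) xs x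
  cases κ <;> simp only [hLoc, h]

/-- Translation subtracts h_i x* from g_i, a linear operation on the pair (g_i, h_i); hence the
coordinates `pack`. -/
theorem gLoc_translate (κ : Curvature) (f : Fin N → Vec n → ℝ) (xs : Vec n) (i : Fin N)
    (x : Vec n) : gLoc κ (translate f xs i) x =
      gLoc κ (f i) (x + xs) - mulVec (hLoc κ (f i) (x + xs)) xs := by
  rw [gLoc, gLoc, hLoc_translate, mulVec_add]
  unfold translate
  rw [gradient_translate]
  abel

theorem isSymm_hLoc (κ : Curvature) {φ : Vec n → ℝ} (hφ : ContDiff ℝ 2 φ) (x : Vec n) :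
    (hLoc κ φ x).IsSymm := by
  cases κ
  · exact isSymm_hessian hφ x
  · exact Matrix.isSymm_diagonal _
  · exact Matrix.isSymm_one

theorem isSymm_hBar (κ : Curvature) {f : Fin N → Vec n → ℝ} (hf : ∀ i, ContDiff ℝ 2 (f i))
    (x : Fin N → Vec n) : (hBar κ f x).IsSymm := by
  rw [Matrix.IsSymm, hBar, avg, Matrix.transpose_smul, Matrix.transpose_sum]
  congr 1
  exact Finset.sum_congr rfl fun i _ => isSymm_hLoc κ (hf i) (x i)

theorem gradient_globalCost {f : Fin N → Vec n → ℝ} (hf : ∀ i, Differentiable ℝ (f i))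
    (x : Vec n) : gradient (globalCost f) x = avg fun i => gradient (f i) x := by
  refine ext_inner_right ℝ fun d => ?_
  have h1 : fderiv ℝ (globalCost f) x = (N : ℝ)⁻¹ • ∑ i, fderiv ℝ (f i) x := by
    have : globalCost f = fun x => (N : ℝ)⁻¹ • ∑ i, f i x := rfl
    rw [this]
    exact (HasFDerivAt.fun_sum fun i _ => (hf i x).hasFDerivAt).const_smul (N : ℝ)⁻¹ |>.fderiv
  rw [inner_gradient_eq, h1, avg, inner_smul_left, sum_inner]
  simp

theorem gBar_const {κ : Curvature} {f : Fin N → Vec n → ℝ}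
    (hf : ∀ i, Differentiable ℝ (f i)) (x : Vec n) :
    gBar κ f (fun _ => x) = mulVec (hBar κ f fun _ => x) x - gradient (globalCost f) x := by
  rw [gradient_globalCost hf, gBar, hBar]
  simp only [gLoc]
  rw [avg_sub]
  congr 1
  exact (map_avg (mulVecRight x).toLinearMap _).symm

theorem contDiff_globalCost {f : Fin N → Vec n → ℝ} (hf : ∀ i, ContDiff ℝ 2 (f i)) :
    ContDiff ℝ 2 (globalCost f) := by
  unfold globalCost avg
  exact (ContDiff.sum fun i _ => hf i).const_smul _

theorem globalCost_translate (f : Fin N → Vec n → ℝ) (xs x : Vec n) :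
    globalCost (translate f xs) x = globalCost f (x + xs) := rfl

theorem quadraticBounds_globalCost {f : Fin N → Vec n → ℝ} {c m : ℝ}
    (h : ConvexityAssumption f c m) {xs : Vec n} (hxs : IsMinOn (globalCost f) Set.univ xs) :
    QuadraticBounds (fun x => globalCost (translate f xs) x - globalCost f xs)
      (fun x => gradient (globalCost (translate f xs)) x) c m := by
  have hF : ContDiff ℝ 2 (globalCost f) :=
    contDiff_globalCost fun i => (h.smooth i).of_le (by norm_num)
  have hg : ∀ x, gradient (globalCost (translate f xs)) x = gradient (globalCost f) (x + xs) :=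
    fun x => gradient_translate (globalCost f) xs x
  refine ⟨h.c_pos, h.m_pos, fun x => ?_, ?_, fun x d => ?_, fun x d => ?_⟩
  · exact sub_nonneg.2 (hxs (Set.mem_univ (x + xs)))
  · rw [globalCost_translate, zero_add, sub_self]
  · have := taylor_le_of_le_hessian hF h.lower (x + xs) d
    simp only [globalCost_translate, hg]
    rw [add_right_comm x d xs]
    linarith
  · have := le_taylor_of_hessian_le hF h.upper (x + xs) d
    simp only [globalCost_translate, hg]
    rw [add_right_comm x d xs]
    linarith

/-- On the diagonal the slow field is a preconditioned negative gradient of the global cost. -/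
theorem psi_const_sub {κ : Curvature} {f : Fin N → Vec n → ℝ} {c : ℝ} (hc : 0 < c)
    (hf : ∀ i, Differentiable ℝ (f i)) {x : Vec n}
    (hl : QuadLE (c • (1 : Mat n)) (hBar κ f fun _ => x)) :
    psi κ f (fun _ => x) - x =
      -mulVec (hBar κ f fun _ => x)⁻¹ (gradient (globalCost f) x) := by
  rw [psi, gBar_const hf, mulVec_sub, inv_mulVec_mulVec hc hl]
  abel

end Costs

/-! ### The algorithm as a two-time-scale system -/

section Fast

variable {N n : ℕ}

/-- The space of the fast variables of one agent, with the Euclidean norm. -/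
def Fast (n : ℕ) : Type := WithLp 2 (Vec n × Mat n)

noncomputable instance : NormedAddCommGroup (Fast n) :=
  inferInstanceAs (NormedAddCommGroup (WithLp 2 (Vec n × Mat n)))

noncomputable instance : NormedSpace ℝ (Fast n) :=
  inferInstanceAs (NormedSpace ℝ (WithLp 2 (Vec n × Mat n)))

/-- The element of `Fast n` with given components. -/
def Fast.mk (p : Vec n) (q : Mat n) : Fast n := WithLp.toLp 2 (p, q)

theorem contracts_fast {P : Matrix (Fin N) (Fin N) ℝ} {ρ : ℝ} (h : Contracts P ρ ℝ) :
    Contracts P ρ (Fast n) :=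
  h.vec.prod h.mat

theorem norm_sq_fast_mk (p : Vec n) (q : Mat n) : ‖Fast.mk p q‖ ^ 2 = ‖p‖ ^ 2 + ‖q‖ ^ 2 :=
  WithLp.prod_norm_sq_eq_of_L2 (WithLp.toLp 2 (p, q))

theorem norm_fast_mk_le (p : Vec n) (q : Mat n) : ‖Fast.mk p q‖ ≤ ‖p‖ + ‖q‖ := by
  refine abs_le_of_sq_le_sq' ?_ (by positivity) |>.2
  rw [norm_sq_fast_mk]
  nlinarith [norm_nonneg p, norm_nonneg q]

theorem norm_fst_le (p : Vec n) (q : Mat n) : ‖p‖ ≤ ‖Fast.mk p q‖ := by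
  refine abs_le_of_sq_le_sq' ?_ (norm_nonneg _) |>.2
  rw [norm_sq_fast_mk]
  linarith [sq_nonneg ‖q‖]

theorem norm_snd_le (p : Vec n) (q : Mat n) : ‖q‖ ≤ ‖Fast.mk p q‖ := by
  refine abs_le_of_sq_le_sq' ?_ (norm_nonneg _) |>.2
  rw [norm_sq_fast_mk]
  linarith [sq_nonneg ‖p‖]

/-- The first component. -/
noncomputable def Fast.fst : Fast n →L[ℝ] Vec n :=
  LinearMap.mkContinuous
    { toFun := fun e => WithLp.fst e
      map_add' := fun _ _ => rfl
      map_smul' := fun _ _ => rfl } 1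
    fun e => by
      rw [one_mul]
      exact norm_fst_le (WithLp.fst e) (WithLp.snd e)

/-- The second component. -/
noncomputable def Fast.snd : Fast n →L[ℝ] Mat n :=
  LinearMap.mkContinuous
    { toFun := fun e => WithLp.snd e
      map_add' := fun _ _ => rfl
      map_smul' := fun _ _ => rfl } 1
    fun e => by
      rw [one_mul]
      exact norm_snd_le (WithLp.fst e) (WithLp.snd e)

theorem norm_fast_mk_sub_le (xs p : Vec n) (q : Mat n) :
    ‖Fast.mk (p - mulVec q xs) q‖ ≤ ‖p‖ + (‖xs‖ + 1) * ‖q‖ := by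
  refine (norm_fast_mk_le _ _).trans ?_
  have h1 := norm_sub_le p (mulVec q xs)
  have h2 := norm_mulVec_le q xs
  linarith

/-- The change of coordinates `(p, q) ↦ (p - q x*, q)` induced by the translation by `x*`. -/
noncomputable def pack (xs : Vec n) : (Vec n × Mat n) →L[ℝ] Fast n :=
  LinearMap.mkContinuous
    { toFun := fun e => Fast.mk (e.1 - mulVec e.2 xs) e.2
      map_add' := fun e e' => by
        rw [Prod.fst_add, Prod.snd_add, add_mulVec, add_sub_add_comm]
        rfl
      map_smul' := fun t e => by
        rw [Prod.smul_fst, Prod.smul_snd, smul_mulVec, ← smul_sub]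
        rfl } (‖xs‖ + 2)
    fun e => by
      refine (norm_fast_mk_sub_le xs e.1 e.2).trans ?_
      have h1 : ‖e.1‖ ≤ ‖e‖ := _root_.norm_fst_le e
      have h2 : (‖xs‖ + 1) * ‖e.2‖ ≤ (‖xs‖ + 1) * ‖e‖ :=
        mul_le_mul_of_nonneg_left (_root_.norm_snd_le e) (by positivity)
      linarith

theorem pack_apply (xs p : Vec n) (q : Mat n) :
    pack xs (p, q) = Fast.mk (p - mulVec q xs) q := rfl

/-- The signals tracked by the fast variables. -/
noncomputable def signal (κ : Curvature) (f : Fin N → Vec n → ℝ) (i : Fin N) (x : Vec n) :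
    Fast n :=
  Fast.mk (gLoc κ (f i) x) (hLoc κ (f i) x)

theorem signal_translate (κ : Curvature) (f : Fin N → Vec n → ℝ) (xs : Vec n) (i : Fin N)
    (x : Vec n) : signal κ (translate f xs) i (x - xs) =
      pack xs (gLoc κ (f i) x, hLoc κ (f i) x) := by
  rw [signal, pack_apply, gLoc_translate, hLoc_translate, sub_add_cancel]

theorem avg_signal (κ : Curvature) (f : Fin N → Vec n → ℝ) (x : Fin N → Vec n) :
    (avg fun j => signal κ f j (x j)) = Fast.mk (gBar κ f x) (hBar κ f x) := by
  have h1 : gBar κ f x = Fast.fst (avg fun j => signal κ f j (x j)) :=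
    (map_avg Fast.fst.toLinearMap fun j => signal κ f j (x j)).symm
  have h2 : hBar κ f x = Fast.snd (avg fun j => signal κ f j (x j)) :=
    (map_avg Fast.snd.toLinearMap fun j => signal κ f j (x j)).symm
  rw [h1, h2]
  rfl

end Fast

/-! ### The constants of the two-time-scale system. -/

section System

variable {N n : ℕ} {G : SimpleGraph (Fin N)} {P : Matrix (Fin N) (Fin N) ℝ} {κ : Curvature}
  {f : Fin N → Vec n → ℝ} {c m : ℝ} {xs : Vec n}

theorem contDiff_translate (hconv : ConvexityAssumption f c m) (xs : Vec n) (i : Fin N) :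
    ContDiff ℝ 2 (translate f xs i) :=
  ((hconv.smooth i).of_le (by norm_num)).comp (contDiff_id.add contDiff_const)

theorem exists_twoTimeScale (hP : IsAverageConsensus G P) (hconv : ConvexityAssumption f c m)
    (hxs : IsMinOn (globalCost f) Set.univ xs) (hglob : GlobalProperties κ (translate f xs) c m) :
    ∃ ρ L a γ δ₀ l b, TwoTimeScale P (signal κ (translate f xs)) (psi κ (translate f xs))
      (fun x => √(globalCost (translate f xs) x - globalCost f xs)) ρ L a γ δ₀ l b := by
  obtain ⟨mg, ag, ah, aψ, -, hag, hah, haψ, hh, -, hgL, hhL, hψL⟩ := hglob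
  obtain ⟨ρ, hρ0, hρ1, hρ⟩ := hP.exists_contracts_real
  have hQ := quadraticBounds_globalCost hconv hxs
  have hc := hconv.c_pos
  have hm := hconv.m_pos
  have hdf : ∀ i, Differentiable ℝ (translate f xs i) := fun i =>
    (contDiff_translate hconv xs i).differentiable (by norm_num)
  have hψ : ∀ x, psi κ (translate f xs) (fun _ => x) - x =
      -mulVec (hBar κ (translate f xs) fun _ => x)⁻¹
        (gradient (globalCost (translate f xs)) x) := fun x =>
    psi_const_sub hc hdf (hh _).1
  refine ⟨ρ, ag + ah, aψ, c / (2 * m), min ((c / m) ^ 2) (m / c), √(m / 2), √(c / 2), ?_⟩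
  refine
    { ρ_nonneg := hρ0
      ρ_lt_one := hρ1
      L_pos := by positivity
      a_pos := haψ
      γ_pos := by positivity
      δ₀_pos := by positivity
      l_pos := by positivity
      b_pos := by positivity
      row_sum := hP.row_sum
      contracts := contracts_fast hρ
      lipschitz_G := fun i x x' => ?_
      lipschitz_Ψ := fun x x' => ?_
      Ψ_zero := ?_
      U_zero := ?_
      U_add_le := hQ.sqrt_add_le
      le_U := hQ.le_sqrt
      U_step_le := fun x δ hδ hδ0 => ?_ }
  · have h1 := norm_fast_mk_le (gLoc κ (translate f xs i) x - gLoc κ (translate f xs i) x')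
      (hLoc κ (translate f xs i) x - hLoc κ (translate f xs i) x')
    refine h1.trans ?_
    rw [add_mul]
    exact add_le_add (hgL i x x') (hhL i x x')
  · rw [nrm_eq_sqrt]
    exact hψL x x'
  · have h1 := hψ 0
    rw [hQ.grad_zero, mulVec_zero, neg_zero, sub_zero] at h1
    exact h1
  · rw [hQ.zero, Real.sqrt_zero]
  · rw [hψ]
    have hl := (hh fun _ => x).1
    set A := hBar κ (translate f xs) fun _ => x with hA
    set g := gradient (globalCost (translate f xs)) x with hg
    have hAp : mulVec A (mulVec A⁻¹ g) = g := mulVec_inv_mulVec hc hl g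
    refine hQ.sqrt_step_le hδ (hδ0.trans (min_le_left _ _)) (hδ0.trans (min_le_right _ _)) ?_ ?_
    -- With A p = g, cocoercivity of h̄ is the angle condition between the direction p and the
    -- gradient.
    · have h1 := norm_mulVec_sq_le hc.le hm (isSymm_hBar κ (contDiff_translate hconv xs) _) hl
        (hh fun _ => x).2 (mulVec A⁻¹ g)
      rw [hAp, real_inner_comm] at h1
      exact h1
    · have h1 := le_norm_mulVec hl (mulVec A⁻¹ g)
      rwa [hAp] at h1

/-- The global bound on ḡ gives |ψ| ≤ mg/c, which makes `C` uniform in the state. -/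
theorem exists_perturbation_bound (hconv : ConvexityAssumption f c m)
    (hglob : GlobalProperties κ (translate f xs) c m) :
    ∃ C : ℝ, 0 ≤ C ∧ ∀ (x : Fin N → Vec n) (y : Vec n) (z : Mat n),
      ‖mulVec (thresh c z)⁻¹ y - xs - psi κ (translate f xs) x‖ ≤
        C * ‖pack xs (y, z) - avg fun j => signal κ (translate f xs) j (x j)‖ := by
  obtain ⟨mg, ag, ah, aψ, hmg, -, -, -, hh, hgb, -, -, -⟩ := hglob
  have hc := hconv.c_pos
  have hm := hconv.m_pos
  refine ⟨2 / c + 2 / c * (‖xs‖ + (2 + 2 * m / c) * (‖xs‖ + mg / c)), by positivity,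
    fun x y z => ?_⟩
  refine (norm_thresh_inv_mulVec_sub_le hc hm (isSymm_hBar κ (contDiff_translate hconv xs) x)
    (hh x).1 (hh x).2 xs y (gBar κ (translate f xs) x) (hgb x)).trans ?_
  rw [add_mul (2 / c), avg_signal, pack_apply]
  have h1 : 0 ≤ 2 / c := by positivity
  have h2 : 0 ≤ 2 / c * (‖xs‖ + (2 + 2 * m / c) * (‖xs‖ + mg / c)) := by positivity
  refine add_le_add (mul_le_mul_of_nonneg_left ?_ h1) (mul_le_mul_of_nonneg_left ?_ h2)
  · exact norm_fst_le (y - mulVec z xs - gBar κ (translate f xs) x)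
      (z - hBar κ (translate f xs) x)
  · exact norm_snd_le (y - mulVec z xs - gBar κ (translate f xs) x)
      (z - hBar κ (translate f xs) x)

end System

/-! ### Coordinates of the state -/

section Coordinates

variable {N n : ℕ}

/-- The registers in translated coordinates. -/
noncomputable def fastV (xs : Vec n) (s : State N n) (i : Fin N) : Fast n :=
  pack xs (s.v i, s.w i)

/-- The consensus variables in translated coordinates. -/
noncomputable def fastY (xs : Vec n) (s : State N n) (i : Fin N) : Fast n :=
  pack xs (s.y i, s.z i)

/-- The local estimates in translated coordinates. -/
noncomputable def slowX (xs : Vec n) (s : State N n) (i : Fin N) : Vec n := s.x i - xs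

theorem avg_pack (xs : Vec n) (p : Fin N → Vec n) (q : Fin N → Mat n) :
    (avg fun i => pack xs (p i, q i)) = pack xs (avg p, avg q) := by
  have h1 := map_avg (pack xs).toLinearMap fun i => (p i, q i)
  have h2 : avg (fun i => (p i, q i)) = (avg p, avg q) := by
    refine Prod.ext ?_ ?_
    · exact map_avg (LinearMap.fst ℝ (Vec n) (Mat n)) fun i => (p i, q i)
    · exact map_avg (LinearMap.snd ℝ (Vec n) (Mat n)) fun i => (p i, q i)
  rw [h2] at h1
  exact h1.symm

theorem avg_fastY_eq (xs : Vec n) {s : State N n} (hs : s ∈ unperturbed N n) :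
    avg (fastY xs s) = avg (fastV xs s) := by
  have hy : avg s.y = avg s.v := sub_eq_zero.1 ((avg_sub s.y s.v).symm.trans hs.1)
  have hz : avg s.z = avg s.w := sub_eq_zero.1 ((avg_sub s.z s.w).symm.trans hs.2)
  have h1 : avg (fastY xs s) = pack xs (avg s.y, avg s.z) := avg_pack xs s.y s.z
  have h2 : avg (fastV xs s) = pack xs (avg s.v, avg s.w) := avg_pack xs s.v s.w
  rw [h1, h2, hy, hz]

theorem norm_pack_le (xs p : Vec n) (q : Mat n) :
    ‖pack xs (p, q)‖ ≤ ‖p‖ + (‖xs‖ + 1) * ‖q‖ :=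
  norm_fast_mk_sub_le xs p q

theorem norm_le_pack_fst (xs p : Vec n) (q : Mat n) :
    ‖p‖ ≤ (‖xs‖ + 1) * ‖pack xs (p, q)‖ := by
  have h1 : ‖p - mulVec q xs‖ ≤ ‖pack xs (p, q)‖ := norm_fst_le _ q
  have h2 : ‖q‖ ≤ ‖pack xs (p, q)‖ := norm_snd_le (p - mulVec q xs) q
  have h3 := norm_add_le (p - mulVec q xs) (mulVec q xs)
  rw [sub_add_cancel] at h3
  have h4 := norm_mulVec_le q xs
  have h5 : ‖q‖ * ‖xs‖ ≤ ‖pack xs (p, q)‖ * ‖xs‖ := by gcongr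
  linarith

theorem norm_le_pack_snd (xs p : Vec n) (q : Mat n) : ‖q‖ ≤ ‖pack xs (p, q)‖ :=
  norm_snd_le (p - mulVec q xs) q

theorem nrm_pack_le (xs : Vec n) (p : Fin N → Vec n) (q : Fin N → Mat n) :
    nrm (fun i => pack xs (p i, q i)) ≤ nrm p + (‖xs‖ + 1) * nrm q := by
  have h0 : 0 ≤ ‖xs‖ + 1 := by positivity
  have h1 : nrm (fun i => pack xs (p i, q i)) ≤
      nrm fun i => ‖p i‖ + (‖xs‖ + 1) • ‖q i‖ := nrm_mono fun i => by
    rw [Real.norm_of_nonneg (by positivity)]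
    exact norm_pack_le xs (p i) (q i)
  refine h1.trans ((nrm_add_le _ _).trans (add_le_add ?_ ?_))
  · exact nrm_mono fun i => (norm_norm _).le
  · rw [nrm_smul h0]
    exact mul_le_mul_of_nonneg_left (nrm_mono fun i => (norm_norm _).le) h0

theorem stateDist_sq (s t : State N n) : stateDist s t ^ 2 =
    nrm (fun i => s.v i - t.v i) ^ 2 + nrm (fun i => s.w i - t.w i) ^ 2
      + nrm (fun i => s.y i - t.y i) ^ 2 + nrm (fun i => s.z i - t.z i) ^ 2
      + nrm (fun i => s.x i - t.x i) ^ 2 := by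
  rw [stateDist, Real.sq_sqrt (Finset.sum_nonneg fun i _ => by positivity)]
  simp only [nrm_sq, Finset.sum_add_distrib]

theorem stateDist_nonneg (s t : State N n) : 0 ≤ stateDist s t := Real.sqrt_nonneg _

theorem nrm_le_stateDist (s t : State N n) :
    nrm (fun i => s.v i - t.v i) ≤ stateDist s t ∧ nrm (fun i => s.w i - t.w i) ≤ stateDist s t ∧
      nrm (fun i => s.y i - t.y i) ≤ stateDist s t ∧
      nrm (fun i => s.z i - t.z i) ≤ stateDist s t ∧
      nrm (fun i => s.x i - t.x i) ≤ stateDist s t := by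
  have h := stateDist_sq s t
  refine ⟨?_, ?_, ?_, ?_, ?_⟩ <;>
  · refine abs_le_of_sq_le_sq' ?_ (stateDist_nonneg s t) |>.2
    rw [h]
    nlinarith [sq_nonneg (nrm fun i => s.v i - t.v i), sq_nonneg (nrm fun i => s.w i - t.w i),
      sq_nonneg (nrm fun i => s.y i - t.y i), sq_nonneg (nrm fun i => s.z i - t.z i),
      sq_nonneg (nrm fun i => s.x i - t.x i)]

theorem sum_sq_le_sq_sum {a b c d e : ℝ} (ha : 0 ≤ a) (hb : 0 ≤ b) (hc : 0 ≤ c) (hd : 0 ≤ d)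
    (he : 0 ≤ e) :
    a ^ 2 + b ^ 2 + c ^ 2 + d ^ 2 + e ^ 2 ≤ (a + b + c + d + e) ^ 2 := by
  have h : 0 ≤ 2 * (a * b + (a + b) * c + (a + b + c) * d + (a + b + c + d) * e) := by positivity
  linarith

theorem stateDist_le (s t : State N n) : stateDist s t ≤
    nrm (fun i => s.v i - t.v i) + nrm (fun i => s.w i - t.w i)
      + nrm (fun i => s.y i - t.y i) + nrm (fun i => s.z i - t.z i)
      + nrm (fun i => s.x i - t.x i) := by
  have h := stateDist_sq s t
  have h1 := nrm_nonneg fun i => s.v i - t.v i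
  have h2 := nrm_nonneg fun i => s.w i - t.w i
  have h3 := nrm_nonneg fun i => s.y i - t.y i
  have h4 := nrm_nonneg fun i => s.z i - t.z i
  have h5 := nrm_nonneg fun i => s.x i - t.x i
  refine abs_le_of_sq_le_sq' ?_
    (add_nonneg (add_nonneg (add_nonneg (add_nonneg h1 h2) h3) h4) h5) |>.2
  rw [h]
  exact sum_sq_le_sq_sum h1 h2 h3 h4 h5

theorem signal_translate_zero (κ : Curvature) (f : Fin N → Vec n → ℝ) (xs : Vec n) (i : Fin N) :
    signal κ (translate f xs) i 0 = pack xs (gLoc κ (f i) xs, hLoc κ (f i) xs) := by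
  rw [← signal_translate, sub_self]

theorem fastV_sub (κ : Curvature) (f : Fin N → Vec n → ℝ) (xs : Vec n) (s : State N n)
    (i : Fin N) : fastV xs s i - signal κ (translate f xs) i 0 =
      pack xs (s.v i - (consensusState κ f xs).v i, s.w i - (consensusState κ f xs).w i) := by
  rw [signal_translate_zero, fastV, ← map_sub]
  rfl

theorem fastY_sub (κ : Curvature) (f : Fin N → Vec n → ℝ) (xs : Vec n) (s : State N n)
    (i : Fin N) : (fastY xs s i - avg fun j => signal κ (translate f xs) j 0) =
      pack xs (s.y i - (consensusState κ f xs).y i, s.z i - (consensusState κ f xs).z i) := by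
  simp only [signal_translate_zero]
  rw [avg_pack, fastY, ← map_sub]
  rfl

/-- `pack` costs a factor ‖xs‖ + 1 on each matrix component; adding the five components gives 2‖xs‖
+ 5. -/
theorem equilibriumDist_le (κ : Curvature) (f : Fin N → Vec n → ℝ) (xs : Vec n)
    (s : State N n) :
    equilibriumDist (signal κ (translate f xs)) (fastV xs s) (fastY xs s) (slowX xs s) ≤
      (2 * ‖xs‖ + 5) * stateDist s (consensusState κ f xs) := by
  obtain ⟨h1, h2, h3, h4, h5⟩ := nrm_le_stateDist s (consensusState κ f xs)
  rw [equilibriumDist]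
  simp only [fastV_sub, fastY_sub]
  have e1 := nrm_pack_le xs (fun i => s.v i - (consensusState κ f xs).v i)
    fun i => s.w i - (consensusState κ f xs).w i
  have e2 := nrm_pack_le xs (fun i => s.y i - (consensusState κ f xs).y i)
    fun i => s.z i - (consensusState κ f xs).z i
  have e3 : nrm (slowX xs s) = nrm fun i => s.x i - (consensusState κ f xs).x i := rfl
  have h0 : 0 ≤ ‖xs‖ + 1 := by positivity
  have e4 := mul_le_mul_of_nonneg_left h2 h0
  have e5 := mul_le_mul_of_nonneg_left h4 h0
  rw [e3]
  linarith

theorem stateDist_le_equilibriumDist (κ : Curvature) (f : Fin N → Vec n → ℝ) (xs : Vec n)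
    (s : State N n) :
    stateDist s (consensusState κ f xs) ≤ (‖xs‖ + 2) *
      equilibriumDist (signal κ (translate f xs)) (fastV xs s) (fastY xs s) (slowX xs s) := by
  have h := stateDist_le s (consensusState κ f xs)
  rw [equilibriumDist]
  simp only [fastV_sub, fastY_sub]
  have h0 : 0 ≤ ‖xs‖ + 1 := by positivity
  have e1 := nrm_le_mul h0 fun i => norm_le_pack_fst xs (s.v i - (consensusState κ f xs).v i)
    (s.w i - (consensusState κ f xs).w i)
  have e2 := nrm_mono fun i => norm_le_pack_snd xs (s.v i - (consensusState κ f xs).v i)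
    (s.w i - (consensusState κ f xs).w i)
  have e3 := nrm_le_mul h0 fun i => norm_le_pack_fst xs (s.y i - (consensusState κ f xs).y i)
    (s.z i - (consensusState κ f xs).z i)
  have e4 := nrm_mono fun i => norm_le_pack_snd xs (s.y i - (consensusState κ f xs).y i)
    (s.z i - (consensusState κ f xs).z i)
  have e5 : nrm (slowX xs s) = nrm fun i => s.x i - (consensusState κ f xs).x i := rfl
  have e6 : 0 ≤ (‖xs‖ + 1) * nrm (slowX xs s) := mul_nonneg h0 (nrm_nonneg _)
  rw [e5] at e6 ⊢
  linarith

end Coordinates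

/-! ### Euler discretization and equilibrium -/

section Equilibrium

variable {N n : ℕ} {G : SimpleGraph (Fin N)} {P : Matrix (Fin N) (Fin N) ℝ} {κ : Curvature}
  {f : Fin N → Vec n → ℝ} {c m ε : ℝ} {xs : Vec n}

theorem sum_one_sub_smul {E : Type*} [AddCommGroup E] [Module ℝ E] (P : Matrix (Fin N) (Fin N) ℝ)
    (u : Fin N → E) (i : Fin N) :
    ∑ j, (1 - P) i j • u j = u i - ∑ j, P i j • u j := by
  simp [Matrix.sub_apply, sub_smul, Finset.sum_sub_distrib, Matrix.one_apply, ite_smul]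

theorem neg_sum_add_sum {E : Type*} [AddCommGroup E] [Module ℝ E] (P : Matrix (Fin N) (Fin N) ℝ)
    (y g v : Fin N → E) (i : Fin N) :
    -(∑ j, (1 - P) i j • y j) + ∑ j, P i j • (g j - v j) =
      ∑ j, P i j • (y j + g j - v j) - y i := by
  rw [sum_one_sub_smul]
  simp only [smul_sub, smul_add, Finset.sum_sub_distrib, Finset.sum_add_distrib]
  abel

theorem step_eq_eulerStep (hε : ε ≠ 0) (s : State N n) :
    step κ f P c ε s = eulerStep (field κ f P c ε) ε s := by
  refine State.ext ?_ ?_ ?_ ?_ ?_ <;> funext i <;>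
    simp only [step, eulerStep, field, Pi.add_apply, Pi.smul_apply]
  · rw [smul_inv_smul₀ hε]
    abel
  · rw [smul_inv_smul₀ hε]
    abel
  · rw [smul_inv_smul₀ hε, neg_sum_add_sum P s.y fun j => gLoc κ (f j) (s.x j)]
    abel
  · rw [smul_inv_smul₀ hε, neg_sum_add_sum P s.z fun j => hLoc κ (f j) (s.x j)]
    abel
  · module

theorem consensusState_mem_unperturbed [NeZero N] :
    consensusState κ f xs ∈ unperturbed N n := by
  refine ⟨?_, ?_⟩
  · change (avg fun i => gBar κ f (fun _ => xs) - gLoc κ (f i) xs) = 0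
    rw [avg_sub, avg_const, gBar, sub_self]
  · change (avg fun i => hBar κ f (fun _ => xs) - hLoc κ (f i) xs) = 0
    rw [avg_sub, avg_const, hBar, sub_self]

theorem hBar_translate_zero : (hBar κ (translate f xs) fun _ => 0) = hBar κ f fun _ => xs := by
  simp only [hBar, hLoc_translate, zero_add]

/-- Since ∇f̄ vanishes at `xs`, ḡ = h̄ x* there, and h̄ ≥ cI keeps the threshold inactive, so the
target of each agent is `xs` itself. -/
theorem field_consensusState (hP : IsAverageConsensus G P) (hconv : ConvexityAssumption f c m)
    (hxs : IsMinOn (globalCost f) Set.univ xs) (hglob : GlobalProperties κ (translate f xs) c m) :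
    field κ f P c ε (consensusState κ f xs) = 0 := by
  obtain ⟨mg, ag, ah, aψ, -, -, -, -, hh, -⟩ := hglob
  have hl : QuadLE (c • (1 : Mat n)) (hBar κ f fun _ => xs) := by
    rw [← hBar_translate_zero]
    exact (hh fun _ => 0).1
  have hc := hconv.c_pos
  have hl2 : QuadLE ((c / 2) • (1 : Mat n)) (hBar κ f fun _ => xs) := by
    rw [quadLE_smul_one_left] at hl ⊢
    intro u
    refine le_trans ?_ (hl u)
    gcongr
    linarith
  have hgrad : gradient (globalCost f) xs = 0 := by
    have := (quadraticBounds_globalCost hconv hxs).grad_zero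
    have h2 := gradient_translate (globalCost f) xs 0
    rw [zero_add] at h2
    exact h2.symm.trans this
  have hg : gBar κ f (fun _ => xs) = mulVec (hBar κ f fun _ => xs) xs := by
    rw [gBar_const fun i => (hconv.smooth i).differentiable (by norm_num), hgrad, sub_zero]
  refine State.ext ?_ ?_ ?_ ?_ ?_ <;> funext i
  · change ε⁻¹ • (-gLoc κ (f i) xs + gLoc κ (f i) xs) = 0
    rw [neg_add_cancel, smul_zero]
  · change ε⁻¹ • (-hLoc κ (f i) xs + hLoc κ (f i) xs) = 0
    rw [neg_add_cancel, smul_zero]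
  · change ε⁻¹ • (-(∑ j, (1 - P) i j • gBar κ f (fun _ => xs))
      + ∑ j, P i j • (gLoc κ (f j) xs - gLoc κ (f j) xs)) = 0
    rw [sum_one_sub_smul P fun _ => gBar κ f fun _ => xs, ← Finset.sum_smul, hP.row_sum]
    simp
  · change ε⁻¹ • (-(∑ j, (1 - P) i j • hBar κ f (fun _ => xs))
      + ∑ j, P i j • (hLoc κ (f j) xs - hLoc κ (f j) xs)) = 0
    rw [sum_one_sub_smul P fun _ => hBar κ f fun _ => xs, ← Finset.sum_smul, hP.row_sum]
    simp
  · change -xs + mulVec (thresh c (hBar κ f fun _ => xs))⁻¹ (gBar κ f fun _ => xs) = 0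
    rw [thresh, if_pos hl2, hg, inv_mulVec_mulVec hc hl, neg_add_cancel]

theorem eulerStep_of_eq_zero {F : State N n → State N n} {s : State N n} (h : F s = 0) (ε : ℝ) :
    eulerStep F ε s = s := by
  have hv : (0 : State N n).v = 0 := rfl
  have hw : (0 : State N n).w = 0 := rfl
  have hy : (0 : State N n).y = 0 := rfl
  have hz : (0 : State N n).z = 0 := rfl
  have hx : (0 : State N n).x = 0 := rfl
  simp only [eulerStep, h, hv, hw, hy, hz, hx, smul_zero, add_zero]

end Equilibrium

/-! ### Trajectories of the algorithm -/

section Discrete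

variable {N n : ℕ} {G : SimpleGraph (Fin N)} {P : Matrix (Fin N) (Fin N) ℝ} {κ : Curvature}
  {f : Fin N → Vec n → ℝ} {c C ε : ℝ} {xs : Vec n}

theorem pack_sum_smul (xs : Vec n) (P : Matrix (Fin N) (Fin N) ℝ) (y g v : Fin N → Vec n)
    (z h w : Fin N → Mat n) (i : Fin N) :
    pack xs (∑ j, P i j • (y j + g j - v j), ∑ j, P i j • (z j + h j - w j)) =
      ∑ j, P i j • (pack xs (y j, z j) + pack xs (g j, h j) - pack xs (v j, w j)) := by
  have h1 : ((∑ j, P i j • (y j + g j - v j), ∑ j, P i j • (z j + h j - w j)) : Vec n × Mat n) =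
      ∑ j, P i j • ((y j, z j) + (g j, h j) - (v j, w j)) := by
    refine Prod.ext ?_ ?_
    · rw [Prod.fst_sum]
      rfl
    · rw [Prod.snd_sum]
      rfl
  rw [h1]
  simp only [map_sum, map_smul, map_sub, map_add]

theorem fastV_step (s : State N n) (i : Fin N) :
    fastV xs (step κ f P c ε s) i = signal κ (translate f xs) i (slowX xs s i) :=
  (signal_translate κ f xs i (s.x i)).symm

theorem fastY_step (s : State N n) (i : Fin N) : fastY xs (step κ f P c ε s) i =
    ∑ j, P i j • (fastY xs s j + signal κ (translate f xs) j (slowX xs s j) - fastV xs s j) := by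
  simp only [slowX, signal_translate]
  exact pack_sum_smul xs P s.y (fun j => gLoc κ (f j) (s.x j)) s.v s.z
    (fun j => hLoc κ (f j) (s.x j)) s.w i

/-- Double stochasticity gives both new averages the value of the average signal. -/
theorem avg_fastY_step (hP : IsAverageConsensus G P) {s : State N n}
    (hs : avg (fastY xs s) = avg (fastV xs s)) :
    avg (fastY xs (step κ f P c ε s)) = avg (fastV xs (step κ f P c ε s)) := by
  have h1 : fastY xs (step κ f P c ε s) = fun i => ∑ j, P i j •
      (fastY xs s j + signal κ (translate f xs) j (slowX xs s j) - fastV xs s j) :=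
    funext fun i => fastY_step s i
  have h2 : fastV xs (step κ f P c ε s) = fun i =>
      signal κ (translate f xs) i (slowX xs s i) := funext fun i => fastV_step s i
  rw [h1, h2, hP.avg_mul, avg_sub, avg_add, hs]
  abel

/-- The fast update is an exact step with θ = 1; only the slow one is perturbed, so η = 0. -/
theorem approxStep_step (hC : 0 ≤ C) (hε : 0 ≤ ε)
    (hp : ∀ (x : Fin N → Vec n) (y : Vec n) (z : Mat n),
      ‖mulVec (thresh c z)⁻¹ y - xs - psi κ (translate f xs) x‖ ≤
        C * ‖pack xs (y, z) - avg fun j => signal κ (translate f xs) j (x j)‖)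
    (s : State N n) :
    ApproxStep P (signal κ (translate f xs)) (psi κ (translate f xs)) C ε 1 0
      (fastV xs s) (fastY xs s) (slowX xs s) (fastV xs (step κ f P c ε s))
      (fastY xs (step κ f P c ε s)) (slowX xs (step κ f P c ε s)) := by
  have h0 : ∀ u : Fin N → Fast n, (∀ i, u i = 0) → nrm u ≤ 1 * 0 := fun u hu => by
    simp [nrm_eq_sqrt, hu]
  refine ⟨h0 _ fun i => ?_, h0 _ fun i => ?_, ?_⟩
  · rw [fastV_step, one_smul]
    abel
  · rw [fastY_step, one_smul]
    abel
  · rw [mul_one, add_zero]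
    have heq : (fun i => slowX xs (step κ f P c ε s) i - (slowX xs s i
        + ε • (psi κ (translate f xs) (slowX xs s) - slowX xs s i))) = fun i =>
        ε • (mulVec (thresh c (s.z i))⁻¹ (s.y i) - xs
          - psi κ (translate f xs) (slowX xs s)) := by
      ext1 i
      simp only [slowX, step]
      module
    rw [heq, nrm_smul hε]
    refine mul_le_mul_of_nonneg_left ((nrm_le_mul hC fun i => hp (slowX xs s) (s.y i) (s.z i)).trans
      (mul_le_mul_of_nonneg_left ?_ hC)) hε
    exact nrm_sub_avg_G_le (signal κ (translate f xs)) (fastV xs s) (fastY xs s) (slowX xs s)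

end Discrete

/-! ### Solutions of the continuous-time system in packed coordinates. -/

section Continuous

variable {N n : ℕ} {G : SimpleGraph (Fin N)} {P : Matrix (Fin N) (Fin N) ℝ} {κ : Curvature}
  {f : Fin N → Vec n → ℝ} {c ε T : ℝ} {xs : Vec n}

/-- The derivative of avg y - avg v is zero because the column sums of `P` are 1. -/
theorem avg_eq_of_flow (hP : IsAverageConsensus G P) {E : Type*} [NormedAddCommGroup E]
    [NormedSpace ℝ E] {v y g : ℝ → Fin N → E}
    (hvc : ∀ i, ContinuousOn (fun t => v t i) (Set.Icc 0 T))
    (hyc : ∀ i, ContinuousOn (fun t => y t i) (Set.Icc 0 T))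
    (hv : ∀ i, ∀ t ∈ Set.Ico 0 T,
      HasDerivWithinAt (fun t => v t i) (ε⁻¹ • (g t i - v t i)) (Set.Ici t) t)
    (hy : ∀ i, ∀ t ∈ Set.Ico 0 T, HasDerivWithinAt (fun t => y t i)
      (ε⁻¹ • (∑ j, P i j • (y t j + g t j - v t j) - y t i)) (Set.Ici t) t)
    (h0 : avg (y 0) = avg (v 0)) : ∀ t ∈ Set.Icc 0 T, avg (y t) = avg (v t) := by
  have hc : ContinuousOn (fun t => avg (y t) - avg (v t)) (Set.Icc 0 T) :=
    (continuous_avg.comp_continuousOn (continuousOn_pi.2 hyc)).sub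
      (continuous_avg.comp_continuousOn (continuousOn_pi.2 hvc))
  have hd : ∀ t ∈ Set.Ico 0 T,
      HasDerivWithinAt (fun t => avg (y t) - avg (v t)) 0 (Set.Ici t) t := by
    intro t ht
    have h1 : HasDerivWithinAt (fun t => avg (y t))
        (avg fun i => ε⁻¹ • (∑ j, P i j • (y t j + g t j - v t j) - y t i)) (Set.Ici t) t :=
      (HasDerivWithinAt.fun_sum fun i _ => hy i t ht).const_smul (N : ℝ)⁻¹
    have h2 : HasDerivWithinAt (fun t => avg (v t))
        (avg fun i => ε⁻¹ • (g t i - v t i)) (Set.Ici t) t :=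
      (HasDerivWithinAt.fun_sum fun i _ => hv i t ht).const_smul (N : ℝ)⁻¹
    refine (h1.sub h2).congr_deriv ?_
    rw [avg_smul ε⁻¹ fun i => ∑ j, P i j • (y t j + g t j - v t j) - y t i,
      avg_smul ε⁻¹ fun i => g t i - v t i, avg_sub (fun i => ∑ j, P i j • (y t j + g t j - v t j)),
      hP.avg_mul, avg_sub (fun i => y t i + g t i), avg_add, avg_sub]
    module
  intro t ht
  have := constant_of_has_deriv_right_zero hc hd t ht
  rw [h0, sub_self] at this
  exact sub_eq_zero.1 this

theorem continuous_hLoc_gLoc (hG : ∀ i, Continuous (signal κ (translate f xs) i)) (i : Fin N) :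
    Continuous (hLoc κ (f i)) ∧ Continuous (gLoc κ (f i)) := by
  have hs : Continuous fun x => signal κ (translate f xs) i (x - xs) :=
    (hG i).comp (continuous_id.sub continuous_const)
  have h1 : Continuous (hLoc κ (f i)) := by
    refine (Fast.snd.continuous.comp hs).congr fun x => ?_
    simp only [Function.comp_apply, signal_translate]
    rfl
  refine ⟨h1, ?_⟩
  refine ((Fast.fst.continuous.comp hs).add
    ((mulVecRight xs).continuous.comp h1)).congr fun x => ?_
  simp only [signal_translate]
  exact sub_add_cancel _ _

theorem continuousOn_consensus {E : Type*} [NormedAddCommGroup E] [NormedSpace ℝ E]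
    (P : Matrix (Fin N) (Fin N) ℝ) (t : ℝ) (i : Fin N) {y g v : Fin N → ℝ → E} {S : Set ℝ}
    (hy : ∀ j, ContinuousOn (y j) S) (hg : ∀ j, ContinuousOn (g j) S)
    (hv : ∀ j, ContinuousOn (v j) S) :
    ContinuousOn (fun τ => t • (-(∑ j, (1 - P) i j • y j τ) + ∑ j, P i j • (g j τ - v j τ))) S := by
  fun_prop

theorem pack_field_v (s : State N n) (i : Fin N) :
    pack xs ((field κ f P c ε s).v i, (field κ f P c ε s).w i) =
      ε⁻¹ • (signal κ (translate f xs) i (slowX xs s i) - fastV xs s i) := by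
  have h : ((field κ f P c ε s).v i, (field κ f P c ε s).w i) =
      ε⁻¹ • ((gLoc κ (f i) (s.x i), hLoc κ (f i) (s.x i)) - (s.v i, s.w i)) := by
    rw [sub_eq_neg_add]
    rfl
  rw [h, map_smul, map_sub, slowX, signal_translate]
  rfl

theorem pack_field_y (s : State N n) (i : Fin N) :
    pack xs ((field κ f P c ε s).y i, (field κ f P c ε s).z i) =
      ε⁻¹ • (∑ j, P i j • (fastY xs s j + signal κ (translate f xs) j (slowX xs s j)
        - fastV xs s j) - fastY xs s i) := by
  have h : ((field κ f P c ε s).y i, (field κ f P c ε s).z i) =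
      ε⁻¹ • ((∑ j, P i j • (s.y j + gLoc κ (f j) (s.x j) - s.v j),
        ∑ j, P i j • (s.z j + hLoc κ (f j) (s.x j) - s.w j)) - (s.y i, s.z i)) := by
    simp only [field]
    rw [neg_sum_add_sum P s.y fun j => gLoc κ (f j) (s.x j),
      neg_sum_add_sum P s.z fun j => hLoc κ (f j) (s.x j)]
    rfl
  rw [h, map_smul, map_sub, pack_sum_smul]
  simp only [slowX, signal_translate]
  rfl

variable {s : ℝ → State N n}

/-- Thresholding enters only the x-equation, so the fast components have continuous right-hand sides
along a solution and genuine right derivatives. -/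
theorem IsSolution.hasDerivWithinAt_fastV (hs : IsSolution (field κ f P c ε) s T)
    (hG : ∀ i, Continuous (signal κ (translate f xs) i)) (i : Fin N) {t : ℝ}
    (ht : t ∈ Set.Ico 0 T) :
    HasDerivWithinAt (fun t => fastV xs (s t) i)
      (ε⁻¹ • (signal κ (translate f xs) i (slowX xs (s t) i) - fastV xs (s t) i))
      (Set.Ici t) t := by
  obtain ⟨hh, hg⟩ := continuous_hLoc_gLoc hG i
  have hx := (hs.x i).continuousOn
  have h1 := (hs.v i).hasDerivWithinAt (t := t)
    (((hs.v i).continuousOn.neg.add (hg.comp_continuousOn hx)).const_smul ε⁻¹) ht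
  have h2 := (hs.w i).hasDerivWithinAt (t := t)
    (((hs.w i).continuousOn.neg.add (hh.comp_continuousOn hx)).const_smul ε⁻¹) ht
  exact ((pack xs).hasFDerivAt.comp_hasDerivWithinAt t (h1.prodMk h2)).congr_deriv
    (pack_field_v (s t) i)

theorem IsSolution.hasDerivWithinAt_fastY (hs : IsSolution (field κ f P c ε) s T)
    (hG : ∀ i, Continuous (signal κ (translate f xs) i)) (i : Fin N) {t : ℝ}
    (ht : t ∈ Set.Ico 0 T) :
    HasDerivWithinAt (fun t => fastY xs (s t) i)
      (ε⁻¹ • (∑ j, P i j • (fastY xs (s t) j + signal κ (translate f xs) j (slowX xs (s t) j)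
        - fastV xs (s t) j) - fastY xs (s t) i)) (Set.Ici t) t := by
  have hc1 : ContinuousOn (fun t => (field κ f P c ε (s t)).y i) (Set.Icc 0 T) :=
    continuousOn_consensus P ε⁻¹ i (fun j => (hs.y j).continuousOn)
      (fun j => (continuous_hLoc_gLoc hG j).2.comp_continuousOn (hs.x j).continuousOn)
      fun j => (hs.v j).continuousOn
  have hc2 : ContinuousOn (fun t => (field κ f P c ε (s t)).z i) (Set.Icc 0 T) :=
    continuousOn_consensus P ε⁻¹ i (fun j => (hs.z j).continuousOn)
      (fun j => (continuous_hLoc_gLoc hG j).1.comp_continuousOn (hs.x j).continuousOn)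
      fun j => (hs.w j).continuousOn
  have h1 := (hs.y i).hasDerivWithinAt hc1 ht
  have h2 := (hs.z i).hasDerivWithinAt hc2 ht
  exact ((pack xs).hasFDerivAt.comp_hasDerivWithinAt t (h1.prodMk h2)).congr_deriv
    (pack_field_y (s t) i)

theorem IsSolution.isIntegralOn_slowX (hs : IsSolution (field κ f P c ε) s T) (xs : Vec n)
    (i : Fin N) :
    IsIntegralOn (fun t => slowX xs (s t) i) (fun t => (field κ f P c ε (s t)).x i) T := by
  refine ⟨(hs.x i).1, fun t ht => ?_⟩
  have h := (hs.x i).2 t ht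
  simp only at h
  simp only [slowX]
  rw [h]
  abel

theorem IsSolution.continuousOn_fast (hs : IsSolution (field κ f P c ε) s T) (xs : Vec n)
    (i : Fin N) : ContinuousOn (fun t => fastV xs (s t) i) (Set.Icc 0 T) ∧
      ContinuousOn (fun t => fastY xs (s t) i) (Set.Icc 0 T) :=
  ⟨(pack xs).continuous.comp_continuousOn ((hs.v i).continuousOn.prodMk (hs.w i).continuousOn),
    (pack xs).continuous.comp_continuousOn ((hs.y i).continuousOn.prodMk (hs.z i).continuousOn)⟩

end Continuous

end NRC

/-! ### The main theorem. -/

theorem mainTheorem1 {N n : ℕ} (G : SimpleGraph (Fin N)) (P : Matrix (Fin N) (Fin N) ℝ)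
    (hP : NRC.IsAverageConsensus G P) (κ : NRC.Curvature) (f : Fin N → NRC.Vec n → ℝ)
    (c m : ℝ) (hconv : NRC.ConvexityAssumption f c m)
    (xs : NRC.Vec n) (hxs : IsMinOn (NRC.globalCost f) Set.univ xs)
    (hglob : NRC.GlobalProperties κ (NRC.translate f xs) c m) :
    ∃ εbar : ℝ, 0 < εbar ∧ εbar ≤ 1 ∧ ∀ ε : ℝ, 0 < ε → ε < εbar →
      (∀ s, NRC.step κ f P c ε s = NRC.eulerStep (NRC.field κ f P c ε) ε s) ∧
      NRC.ContinuousGES (NRC.field κ f P c ε) (NRC.unperturbed N n)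
        (NRC.consensusState κ f xs) ∧
      NRC.DiscreteGES (NRC.step κ f P c ε) (NRC.unperturbed N n)
        (NRC.consensusState κ f xs) ∧
      ∃ r : ℝ, 0 < r ∧ r < 1 ∧ ∀ s₀ : NRC.State N n, NRC.xiY s₀ = 0 → NRC.xiZ s₀ = 0 →
        ∀ i, (∃ C : ℝ, ∀ k, ‖(NRC.run κ f P c ε s₀ k).x i - xs‖ ≤ C * r ^ k) ∧
          Filter.Tendsto (fun k => (NRC.run κ f P c ε s₀ k).x i) Filter.atTop (nhds xs) := by
  open NRC in
  have := hP.neZero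
  obtain ⟨ρ, L, a, γ, δ₀, l, b, hS⟩ := exists_twoTimeScale hP hconv hxs hglob
  obtain ⟨C, hC, hp⟩ := exists_perturbation_bound hconv hglob
  obtain ⟨ν, μ, εbar, r, D, hν, hμ, hεb, hεb1, hr, hr2, hD, hstep⟩ := hS.exists_lyap_le hC
  obtain ⟨K₁, hK₁, hle⟩ := hS.lyap_le hν hμ
  obtain ⟨K₂, hK₂, hge⟩ := hS.le_lyap hν hμ
  refine ⟨εbar, hεb, hεb1, fun ε hε hεε => ?_⟩
  have hE : ∀ s, step κ f P c ε s = eulerStep (field κ f P c ε) ε s :=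
    fun s => step_eq_eulerStep hε.ne' s
  have hF : field κ f P c ε (consensusState κ f xs) = 0 :=
    field_consensusState hP hconv hxs hglob
  set V : State N n → ℝ := fun s => lyap (signal κ (translate f xs))
    (fun x => √(globalCost (translate f xs) x - globalCost f xs)) ν μ (fastV xs s) (fastY xs s)
    (slowX xs s) with hV
  set α : ℝ := (‖xs‖ + 2) * K₂ * (K₁ * (2 * ‖xs‖ + 5)) with hα
  have hα0 : 0 < α := by positivity
  have hup : ∀ s, V s ≤ K₁ * (2 * ‖xs‖ + 5) * stateDist s (consensusState κ f xs) := fun s => by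
    refine (hle _ _ _).trans ?_
    rw [mul_assoc]
    exact mul_le_mul_of_nonneg_left (equilibriumDist_le κ f xs s) hK₁.le
  have hlow : ∀ s, stateDist s (consensusState κ f xs) ≤ (‖xs‖ + 2) * K₂ * V s := fun s => by
    refine (stateDist_le_equilibriumDist κ f xs s).trans ?_
    rw [mul_assoc]
    exact mul_le_mul_of_nonneg_left (hge _ _ _) (by positivity)
  -- Used with q = (1 - rε)^k for the algorithm and q = e^(-rt) for the flow.
  have hdecay : ∀ s s' q, 0 ≤ q → V s' ≤ q * V s → stateDist s' (consensusState κ f xs) ≤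
      α * q * stateDist s (consensusState κ f xs) := fun s s' q hq h => by
    calc stateDist s' (consensusState κ f xs) ≤ (‖xs‖ + 2) * K₂ * V s' := hlow s'
      _ ≤ (‖xs‖ + 2) * K₂ * (q * (K₁ * (2 * ‖xs‖ + 5)
          * stateDist s (consensusState κ f xs))) := by
          refine mul_le_mul_of_nonneg_left (h.trans ?_) (by positivity)
          exact mul_le_mul_of_nonneg_left (hup s) hq
      _ = _ := by rw [hα]; ring
  have hε1 : ε < 1 := hεε.trans_le hεb1
  have hq0 : 0 < 1 - r * ε := by nlinarith
  have hq1 : 1 - r * ε < 1 := by linarith [mul_pos hr hε]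
  have hD1 : ∀ s₀ ∈ unperturbed N n, ∀ k : ℕ,
      stateDist ((step κ f P c ε)^[k] s₀) (consensusState κ f xs) ≤
        α * (1 - r * ε) ^ k * stateDist s₀ (consensusState κ f xs) := by
    intro s₀ hs₀ k
    refine hdecay _ _ _ (by positivity) ?_
    have hk : avg (fastY xs ((step κ f P c ε)^[k] s₀)) = avg (fastV xs ((step κ f P c ε)^[k] s₀)) ∧
        V ((step κ f P c ε)^[k] s₀) ≤ (1 - r * ε) ^ k * V s₀ := by
      induction k with
      | zero => exact ⟨avg_fastY_eq xs hs₀, by simp⟩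
      | succ k ih =>
        rw [Function.iterate_succ_apply']
        refine ⟨avg_fastY_step hP ih.1, ?_⟩
        -- An iteration is an approximate step with θ = 1 and η = 0.
        have h1 := hstep ε 1 0 hε hεε zero_le_one le_rfl le_rfl _ _ _ _ _ _ ih.1
          (approxStep_step (κ := κ) (f := f) (P := P) hC hε.le hp ((step κ f P c ε)^[k] s₀))
        rw [mul_one, mul_zero, mul_zero, add_zero] at h1
        refine h1.trans ?_
        rw [pow_succ']
        calc _ ≤ (1 - r * ε) * ((1 - r * ε) ^ k * V s₀) :=
              mul_le_mul_of_nonneg_left ih.2 hq0.le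
          _ = _ := by ring
    exact hk.2
  refine ⟨hE, ⟨consensusState_mem_unperturbed, hF, α, r, hα0, hr, ?_⟩,
    ⟨consensusState_mem_unperturbed, ?_, α, 1 - r * ε, hα0, hq0, hq1, hD1⟩,
    1 - r * ε, hq0, hq1, ?_⟩
  · intro T s hs hs0 t ht
    refine hdecay _ _ _ (Real.exp_pos _).le ?_
    have hv := fun i t ht => hs.hasDerivWithinAt_fastV hS.continuous_G (xs := xs) i (t := t) ht
    have hy := fun i t ht => hs.hasDerivWithinAt_fastY hS.continuous_G (xs := xs) i (t := t) ht
    have hvc := fun i => (hs.continuousOn_fast xs i).1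
    have hyc := fun i => (hs.continuousOn_fast xs i).2
    have h1 := hS.lyap_le_exp (x := fun t => slowX xs (s t)) (v := fun t => fastV xs (s t))
      (y := fun t => fastY xs (s t)) (φ := fun t => (field κ f P c ε (s t)).x) hC hD hε hε1.le
      (fun θ η => hstep ε θ η hε hεε) hvc hyc hv hy (hs.isIntegralOn_slowX xs) (fun i t _ => ?_)
      (avg_eq_of_flow hP hvc hyc hv hy (avg_fastY_eq xs hs0)) t ht
    · rw [mul_comm]
      exact h1
    · have h2 := hp (slowX xs (s t)) ((s t).y i) ((s t).z i)
      refine le_trans (le_of_eq (congrArg _ ?_)) h2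
      simp only [field, slowX]
      abel
  · rw [hE, eulerStep_of_eq_zero hF]
  · intro s₀ hy0 hz0 i
    have hb : ∀ k, ‖(run κ f P c ε s₀ k).x i - xs‖ ≤
        α * stateDist s₀ (consensusState κ f xs) * (1 - r * ε) ^ k := fun k => by
      calc ‖(run κ f P c ε s₀ k).x i - xs‖
          ≤ nrm fun i => (run κ f P c ε s₀ k).x i - (consensusState κ f xs).x i :=
            norm_le_nrm (fun i => (run κ f P c ε s₀ k).x i - (consensusState κ f xs).x i) i
        _ ≤ stateDist (run κ f P c ε s₀ k) (consensusState κ f xs) :=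
            (nrm_le_stateDist _ _).2.2.2.2
        _ ≤ _ := hD1 s₀ ⟨hy0, hz0⟩ k
        _ = _ := by ring
    refine ⟨⟨_, hb⟩, ?_⟩
    rw [tendsto_iff_norm_sub_tendsto_zero]
    refine squeeze_zero (fun _ => norm_nonneg _) hb ?_
    simpa using (tendsto_pow_atTop_nhds_zero_of_lt_one hq0.le hq1).const_mul
      (α * stateDist s₀ (consensusState κ f xs))
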